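/- Let $(M,g)$ be a smooth four-dimensional Lorentzian spin manifold with Levi-Civita connection $\nabla_{AA'}$ (lifted to spinors), and let $(o_A,\iota_A)$ be a smooth normalized spinor dyad on $M$, $o_A\iota^A=1$, where $\xi^A=\epsilon^{AB}\xi_B$. Let $\mathcal S_{k,l}$ be the space of smooth symmetric spinor fields $\phi_{A_1\dots A_kA'_1\dots A'_l}$. The symmetric product $\phi\overset{i,j}{\odot}\psi$ contracts $i$ unprimed and $j$ primed index pairs (the contracted indices of $\phi$ being upper, those of $\psi$ lower) and symmetrizes over all remaining unprimed and over all remaining primed indices. The fundamental spinor operators on $\mathcal S_{k,l}$ are $$\mathscr D\phi=\nabla\overset{1,1}{\odot}\phi,\quad \mathscr C\phi=\nabla\overset{0,1}{\odot}\phi,\quad \mathscr C^\dagger\phi=\nabla\overset{1,0}{\odot}\phi,\quad \mathscr T\phi=\nabla\overset{0,0}{\odot}\phi ,$$ with values in $\mathcal S_{k-1,l-1}$ ($k,l\ge1$), $\mathcal S_{k+1,l-1}$ ($l\ge1$), $\mathcal S_{k-1,l+1}$ ($k\ge1$) and $\mathcal S_{k+1,l+1}$, respectively. The components of $\phi\in\mathcal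 S_{k,l}$ are, for $0\le i\le k$, $0\le j\le l$, $$\phi_{ij'}=\bigl(o_{(A_1}\cdots o_{A_{k-i}}\iota_{A_{k-i+1}}\cdots\iota_{A_k)}\,\bar o_{(A'_1}\cdots\bar o_{A'_{l-j}}\bar\iota_{A'_{l-j+1}}\cdots\bar\iota_{A'_l)}\bigr)\overset{k,l}{\odot}\phi,$$ scalars of weight $\{k-2i,l-2j\}$; components with indices out of range are zero. On fields of weight $\{p,q\}$ put $\Theta_{AA'}=\nabla_{AA'}-p\,\omega_{AA'}-q\,\bar\omega_{AA'}$ with $\omega_{AA'}=\iota^B\nabla_{AA'}o_B$ ($o_A$ has weight $\{1,0\}$, $\iota_A$ weight $\{-1,0\}$). The GHP operators þ, þ$'$, ð, ð$'$ and the spin coefficients are defined by $$\Theta_{AA'}=\iota_A\bar\iota_{A'}\text{þ}-\iota_A\bar o_{A'}\text{ð}-o_A\bar\iota_{A'}\text{ð}'+o_A\bar o_{A'}\text{þ}',$$ $$\Theta_{AA'}o_B=(-\iota_A\bar\iota_{A'}\kappa+\iota_A\bar o_{A'}\sigma+o_A\bar\iota_{A'}\rho-o_A\bar o_{A'}\tau)\,\iota_B,$$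 $$\Theta_{AA'}\iota_B=(-\iota_A\bar\iota_{A'}\tau'+\iota_A\bar o_{A'}\rho'+o_A\bar\iota_{A'}\sigma'-o_A\bar o_{A'}\kappa')\,o_B .$$ Then for every $\phi\in\mathcal S_{k,l}$, at every point, and for all $i,j$ in the index range of the respective left-hand side (if $k,l\ge 1$ for $\mathscr D$, $l\ge1$ for $\mathscr C$, $k\ge1$ for $\mathscr C^\dagger$): $$\begin{aligned} (\mathscr{D}\phi)_{ij'} ={}& (\text{þ} - (k-i) \rho - (l-j) \bar\rho)\phi_{(i+1)(j+1)'} + (\text{þ}' - (i+1) \rho' - (j+1) \bar\rho')\phi_{ij'} \\ &- (\text{ð} - (k-i)\tau - (j+1) \bar{\tau}')\phi_{(i+1)j'} - (\text{ð}' - (i+1) \tau' - (l-j)\bar{\tau})\phi_{i(j+1)'} \\ & + (k-i-1) \kappa \phi_{(i+2)(j+1)'} - (k-i-1) \sigma \phi_{(i+2)j'} - i \sigma' \phi_{(i-1)(j+1)'} + i \kappa' \phi_{(i-1)j'} \\ &+ (l-j-1) \bar\kappa \phi_{(i+1)(j+2)'} - (l-j-1) \bar\sigma \phi_{i(j+2)'}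 - j \bar\sigma' \phi_{(i+1)(j-1)'} + j \bar\kappa' \phi_{i(j-1)'}, \end{aligned}$$ $$\begin{aligned} (k+1)(\mathscr{C}\phi)_{ij'} ={}& -(k-i+1)(\text{þ} + i \rho - (l-j) \bar\rho)\phi_{i(j+1)'} + i(\text{þ}' +(k-i+1)\rho' -(j+1) \bar\rho')\phi_{(i-1)j'} \\ & + (k-i+1)(\text{ð} + i \tau - (j+1) \bar\tau')\phi_{ij'} - i(\text{ð}' + (k-i+1)\tau'-(l-j) \bar\tau)\phi_{(i-1)(j+1)'} \\ & - (k-i+1)(k-i) \kappa \phi_{(i+1)(j+1)'} +(k-i+1)(k-i) \sigma \phi_{(i+1)j'} - i(i-1) \sigma' \phi_{(i-2)(j+1)'} + i(i-1) \kappa' \phi_{(i-2)j'}\\ & -(k-i+1)(l-j-1) \bar\kappa \phi_{i(j+2)'} -i(l-j-1) \bar\sigma \phi_{(i-1)(j+2)'} + (k-i+1)j \bar\sigma' \phi_{i(j-1)'} +ij \bar\kappa' \phi_{(i-1)(j-1)'}, \end{aligned}$$ $$\begin{aligned} (l+1)(\mathscr{C}^\dagger\phi)_{ij'} ={}& -(l-j+1)(\text{þ}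 + j \bar\rho - (k-i) \rho)\phi_{(i+1)j'} +j(\text{þ}' +(l-j+1)\bar\rho' -(i+1) \rho')\phi_{i(j-1)'} \\ & + (l-j+1)(\text{ð}' + j \bar\tau - (i+1) \tau')\phi_{ij'} -j(\text{ð} + (l-j+1)\bar\tau'-(k-i) \tau)\phi_{(i+1)(j-1)'} \\ &- (l-j+1)(l-j) \bar\kappa \phi_{(i+1)(j+1)'} +(l-j+1)(l-j) \bar\sigma \phi_{i(j+1)'} - j(j-1) \bar\sigma' \phi_{(i+1)(j-2)'} + j(j-1) \bar\kappa' \phi_{i(j-2)'}\\ & -(l-j+1)(k-i-1) \kappa \phi_{(i+2)j'} -j(k-i-1) \sigma \phi_{(i+2)(j-1)'} + (l-j+1)i \sigma' \phi_{(i-1)j'} +ij \kappa' \phi_{(i-1)(j-1)'}, \end{aligned}$$ $$\begin{aligned} (k+1)(l+1)(\mathscr{T}\phi)_{ij'} ={}& (k+1-i)(l+1-j)(\text{þ} + i \rho + j\bar\rho)\phi_{ij'} +(k+1-i)j(\text{ð} + i\tau + (l-j+1)\bar\tau')\phi_{i(j-1)'} \\ &+i(l+1-j)(\text{ð}' + (k-i+1)\tau'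 + j\bar\tau)\phi_{(i-1)j'} +ij(\text{þ}' +(k-i+1)\rho' +(l-j+1)\bar\rho')\phi_{(i-1)(j-1)'} \\ &+(k-i+1)(k-i)(l+1-j) \kappa \phi_{(i+1)j'} + (k-i+1)(k-i)j \sigma \phi_{(i+1)(j-1)'} \\ &+i(i-1)(l+1-j) \sigma' \phi_{(i-2)j'} +i(i-1)j \kappa' \phi_{(i-2)(j-1)'} \\ &+(k+1-i)(l+1-j)(l-j) \bar\kappa \phi_{i(j+1)'} + i(l+1-j)(l-j) \bar\sigma \phi_{(i-1)(j+1)'}\\ &+(k+1-i)j(j-1) \bar\sigma' \phi_{i(j-2)'} +ij(j-1) \bar\kappa' \phi_{(i-1)(j-2)'} . \end{aligned}$$ -/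

import Mathlib

open scoped Manifold ContDiff ComplexConjugate

noncomputable section

namespace GHP

/-- The model space of a four-dimensional manifold. -/
abbrev E4 : Type := EuclideanSpace ℝ (Fin 4)

/-- The Minkowski metric `diag(1, -1, -1, -1)`. -/
def minkowski (a b : Fin 4) : ℝ := if a = b then (if a = 0 then 1 else -1) else 0

/-- A four-dimensional Lorentzian spin manifold `(M, g)` of signature `(+,-,-,-)` on which a
reference spin frame is given. A spin frame is, up to its overall sign, the same thing as a smooth
`g`-orthonormal tetrad (see `ivdw` for the correspondence). All spinor indices below are
numerical indices `0, 1` with respect to this reference spin frame. A spinor dyad trivializes the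
spinor bundle over its domain of definition, so that on the domain of a dyad there
always is a reference spin frame. The smoothness, nondegeneracy and signature of `g` follow from
the existence of the tetrad. -/
structure SpinSpacetime (M : Type*) [TopologicalSpace M] [ChartedSpace E4 M]
    [IsManifold 𝓘(ℝ, E4) ∞ M] where
  /-- the Lorentzian metric -/
  g : ∀ x : M, TangentSpace 𝓘(ℝ, E4) x →ₗ[ℝ] TangentSpace 𝓘(ℝ, E4) x →ₗ[ℝ] ℝ
  g_symm : ∀ x v w, g x v w = g x w v
  /-- the orthonormal tetrad `e_0, e_1, e_2, e_3` of the reference spin frame -/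
  tetrad : Fin 4 → ∀ x : M, TangentSpace 𝓘(ℝ, E4) x
  tetrad_smooth : ∀ a, ContMDiff 𝓘(ℝ, E4) 𝓘(ℝ, E4).tangent ∞
    (fun x => (⟨x, tetrad a x⟩ : TangentBundle 𝓘(ℝ, E4) M))
  orthonormal : ∀ x a b, g x (tetrad a x) (tetrad b x) = minkowski a b

/-- Spinor fields `φ_{A₁…A_k A'₁…A'_l}` of valence `(k,l)`, all indices lowered, given by their
components in the reference spin frame (and its complex conjugate). -/
abbrev SpinorField (M : Type*) (k l : ℕ) : Type _ :=
  (Fin k → Fin 2) → (Fin l → Fin 2) → M → ℂ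

/-- The components `ε_{AB} = ε^{AB}`, with `ε_{01} = 1`; the components of `ε̄_{A'B'}` are
the same. Indices are moved by `ξ^A = ε^{AB} ξ_B` and `ξ_B = ξ^A ε_{AB}`. -/
def eps (A B : Fin 2) : ℂ := if A = 0 ∧ B = 1 then 1 else if A = 1 ∧ B = 0 then -1 else 0

/-- Raising an index: `ξ^A = ε^{AB} ξ_B`. -/
def raise (ξ : Fin 2 → ℂ) (A : Fin 2) : ℂ := ∑ B, eps A B * ξ B

section Algebra

variable {M : Type*}

/-- Symmetrization over all unprimed and over all primed indices. -/
def symmetrize {k l : ℕ} (T : SpinorField M k l) : SpinorField M k l := fun A A' x =>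
  ((k.factorial : ℂ) * (l.factorial : ℂ))⁻¹ *
    ∑ s : Equiv.Perm (Fin k), ∑ t : Equiv.Perm (Fin l), T (A ∘ s) (A' ∘ t) x

/-- The space `S_{k,l}` of smooth symmetric spinor fields of valence `(k,l)`. -/
def symSpinors (M : Type*) [TopologicalSpace M] [ChartedSpace E4 M] (k l : ℕ) :
    Set (SpinorField M k l) :=
  {φ | (∀ A A', ContMDiff 𝓘(ℝ, E4) 𝓘(ℝ, ℂ) ∞ (φ A A')) ∧
    ∀ (s : Equiv.Perm (Fin k)) (t : Equiv.Perm (Fin l)) A A', φ (A ∘ s) (A' ∘ t) = φ A A'}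

/-- Contraction of `i` unprimed and `j` primed index pairs of a two-block spinor `T`, followed by
symmetrization. The contracted indices of the first block are the upper ones:
`T^{…B₁…B_i B'₁…B'_j}_{…B₁…B_i B'₁…B'_j}`, where `T^{B}_{B} = ε^{BC} T_{C B}`.
(In the result the `n` free indices of the second block are listed before the `k` free indices
of the first one, which is immaterial because of the symmetrization.) -/
def symContract {k l n m : ℕ} (i j : ℕ)
    (T : (Fin (k + i) → Fin 2) → (Fin (l + j) → Fin 2) → SpinorField M (n + i) (m + j)) :
    SpinorField M (n + k) (m + l) :=
  symmetrize fun A A' x =>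
    ∑ B : Fin i → Fin 2, ∑ C : Fin i → Fin 2, ∑ B' : Fin j → Fin 2, ∑ C' : Fin j → Fin 2,
      (∏ r, eps (B r) (C r)) * (∏ r, eps (B' r) (C' r)) *
        T (Fin.append (fun r => A (Fin.natAdd n r)) C)
          (Fin.append (fun r => A' (Fin.natAdd m r)) C')
          (Fin.append (fun r => A (Fin.castAdd k r)) B)
          (Fin.append (fun r => A' (Fin.castAdd l r)) B') x

/-- The symmetric product `φ ⊙^{i,j} ψ` of `φ` of valence `(k+i, l+j)` and `ψ` of valence
`(n+i, m+j)`. -/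
def symProd {k l n m : ℕ} (i j : ℕ) (φ : SpinorField M (k + i) (l + j))
    (ψ : SpinorField M (n + i) (m + j)) : SpinorField M (n + k) (m + l) :=
  symContract i j fun A A' B B' x => φ A A' x * ψ B B' x

end Algebra

section DyadSection

variable {M : Type*} [TopologicalSpace M] [ChartedSpace E4 M]

/-- A smooth normalized spinor dyad `(o_A, ι_A)`, `o_A ι^A = 1`. -/
structure Dyad (M : Type*) [TopologicalSpace M] [ChartedSpace E4 M] where
  o : Fin 2 → M → ℂ
  iota : Fin 2 → M → ℂ
  o_smooth : ∀ A, ContMDiff 𝓘(ℝ, E4) 𝓘(ℝ, ℂ) ∞ (o A)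
  iota_smooth : ∀ A, ContMDiff 𝓘(ℝ, E4) 𝓘(ℝ, ℂ) ∞ (iota A)
  normalized : ∀ x, ∑ A, o A x * raise (fun B => iota B x) A = 1

namespace Dyad

/-- `o^A` -/
def oUp (d : Dyad M) (x : M) : Fin 2 → ℂ := raise fun B => d.o B x

/-- `ι^A` -/
def iotaUp (d : Dyad M) (x : M) : Fin 2 → ℂ := raise fun B => d.iota B x

/-- The symmetric basis spinor of valence `(k,l)` with `n` factors `o`, `k - n` factors `ι`,
`m` factors `ō` and `l - m` factors `ῑ`. -/
def basis (d : Dyad M) (n k m l : ℕ) : SpinorField M k l :=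
  symmetrize fun A A' x =>
    (∏ r : Fin k, if (r : ℕ) < n then d.o (A r) x else d.iota (A r) x) *
      ∏ r : Fin l, if (r : ℕ) < m then conj (d.o (A' r) x) else conj (d.iota (A' r) x)

/-- The scalar components `φ_{ij'}`, that is the full contraction with `⊙^{k,l}` of the basis
spinor with `k - i` factors `o` and `l - j` factors `ō` with `φ`; by convention zero unless
`0 ≤ i ≤ k` and `0 ≤ j ≤ l`. -/
def comp (d : Dyad M) {k l : ℕ} (φ : SpinorField M k l) (i j : ℤ) : M → ℂ := fun x =>
  if 0 ≤ i ∧ i ≤ k ∧ 0 ≤ j ∧ j ≤ l then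
    symProd (k := 0) (l := 0) (n := 0) (m := 0) k l
      (d.basis (k - i).toNat (0 + k) (l - j).toNat (0 + l))
      (fun A A' => φ (A ∘ Fin.cast (Nat.zero_add k).symm) (A' ∘ Fin.cast (Nat.zero_add l).symm))
      ![] ![] x
  else 0

/-- `o_A` as a spinor field of valence `(1,0)`. -/
def oField (d : Dyad M) : SpinorField M 1 0 := fun A _ => d.o (A 0)

/-- `ι_A` as a spinor field of valence `(1,0)`. -/
def iotaField (d : Dyad M) : SpinorField M 1 0 := fun A _ => d.iota (A 0)

/-- `o_A ι^B - ι_A o^B = δ_A^B`. -/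
theorem completeness (d : Dyad M) (x : M) (A B : Fin 2) :
    d.o A x * d.iotaUp x B - d.iota A x * d.oUp x B = if A = B then 1 else 0 := by
  have h := d.normalized x
  simp [raise, eps, Fin.sum_univ_two] at h
  fin_cases A <;> fin_cases B <;>
    simp [Dyad.oUp, Dyad.iotaUp, raise, eps] <;> first | ring1 | linear_combination h

/-- The dyad expansion of a spinor `T_{AA'}`. -/
theorem expansion (d : Dyad M) (x : M) (T : Fin 2 → Fin 2 → ℂ) (A A' : Fin 2) :
    T A A' =
      d.iota A x * conj (d.iota A' x) * (∑ B, ∑ B', d.oUp x B * conj (d.oUp x B') * T B B')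
      - d.iota A x * conj (d.o A' x) * (∑ B, ∑ B', d.oUp x B * conj (d.iotaUp x B') * T B B')
      - d.o A x * conj (d.iota A' x) * (∑ B, ∑ B', d.iotaUp x B * conj (d.oUp x B') * T B B')
      + d.o A x * conj (d.o A' x) *
          (∑ B, ∑ B', d.iotaUp x B * conj (d.iotaUp x B') * T B B') := by
  have h : T A A' = ∑ B, ∑ B', (d.o A x * d.iotaUp x B - d.iota A x * d.oUp x B) *
      conj (d.o A' x * d.iotaUp x B' - d.iota A' x * d.oUp x B') * T B B' := by
    simp only [completeness]
    simp [apply_ite]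
  rw [h]
  simp only [Fin.sum_univ_two, map_sub, map_mul]
  ring

/-- `ι^A o_A = 1`. -/
theorem contr (d : Dyad M) (x : M) : ∑ B, d.iotaUp x B * d.o B x = 1 := by
  have h := d.normalized x
  simp [raise, eps, Fin.sum_univ_two, Dyad.iotaUp] at h ⊢
  linear_combination h

/-- `o^A ι_A = -1`. -/
theorem contr' (d : Dyad M) (x : M) : ∑ B, d.oUp x B * d.iota B x = -1 := by
  have h := d.normalized x
  simp [raise, eps, Fin.sum_univ_two, Dyad.oUp] at h ⊢
  linear_combination -h

/-- `v_A = o_A ι^B v_B - ι_A o^B v_B`. -/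
theorem expansion_one (d : Dyad M) (x : M) (v : Fin 2 → ℂ) (A : Fin 2) :
    v A = d.o A x * (∑ B, d.iotaUp x B * v B) - d.iota A x * (∑ B, d.oUp x B * v B) := by
  have h : v A = ∑ B, (d.o A x * d.iotaUp x B - d.iota A x * d.oUp x B) * v B := by
    simp only [completeness]
    simp
  rw [h]
  simp only [Fin.sum_univ_two]
  ring

end Dyad

end DyadSection

section Operators

variable {M : Type*} [TopologicalSpace M] [ChartedSpace E4 M] [IsManifold 𝓘(ℝ, E4) ∞ M]

namespace SpinSpacetime

/-- The Levi-Civita connection in the tetrad, by the Koszul formula: `g(∇_{e_a} e_b, e_c)`. -/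
def lcCoeff (X : SpinSpacetime M) (a b c : Fin 4) (x : M) : ℝ :=
  (X.g x (VectorField.mlieBracket 𝓘(ℝ, E4) (X.tetrad a) (X.tetrad b) x) (X.tetrad c x)
    - X.g x (VectorField.mlieBracket 𝓘(ℝ, E4) (X.tetrad b) (X.tetrad c) x) (X.tetrad a x)
    + X.g x (VectorField.mlieBracket 𝓘(ℝ, E4) (X.tetrad c) (X.tetrad a) x) (X.tetrad b x)) / 2

/-- The connection is metric. -/
theorem lcCoeff_antisymm (X : SpinSpacetime M) (a b c : Fin 4) (x : M) :
    X.lcCoeff a b c x = -X.lcCoeff a c b x := by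
  unfold lcCoeff
  rw [VectorField.mlieBracket_swap_apply (V := X.tetrad c) (W := X.tetrad a),
    VectorField.mlieBracket_swap_apply (V := X.tetrad c) (W := X.tetrad b),
    VectorField.mlieBracket_swap_apply (V := X.tetrad b) (W := X.tetrad a)]
  simp only [map_neg, LinearMap.neg_apply]
  ring

/-- The connection is torsion-free: `∇_a e_b - ∇_b e_a = [e_a, e_b]`. -/
theorem lcCoeff_torsion_free (X : SpinSpacetime M) (a b c : Fin 4) (x : M) :
    X.lcCoeff a b c x - X.lcCoeff b a c x =
      X.g x (VectorField.mlieBracket 𝓘(ℝ, E4) (X.tetrad a) (X.tetrad b) x) (X.tetrad c x) := by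
  unfold lcCoeff
  rw [VectorField.mlieBracket_swap_apply (V := X.tetrad c) (W := X.tetrad a),
    VectorField.mlieBracket_swap_apply (V := X.tetrad c) (W := X.tetrad b),
    VectorField.mlieBracket_swap_apply (V := X.tetrad b) (W := X.tetrad a)]
  simp only [map_neg, LinearMap.neg_apply]
  ring

/-- The connection coefficients `ω_a^b_c`: `∇_{e_a} e_c = ω_a^b_c e_b`. -/
def lcForm (X : SpinSpacetime M) (a b c : Fin 4) (x : M) : ℝ :=
  minkowski b b * X.lcCoeff a c b x

end SpinSpacetime

/-- The Infeld–van der Waerden symbols `σ_b^{BB'}` relating the tetrad to the spin frame: a vector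
`V^b e_b` has the spinor components `V^{BB'} = σ_b^{BB'} V^b`. -/
def ivdw (b : Fin 4) (B B' : Fin 2) : ℂ :=
  ((Real.sqrt 2 : ℝ) : ℂ)⁻¹ *
    (![!![1, 0; 0, 1], !![0, 1; 1, 0], !![0, Complex.I; -Complex.I, 0], !![1, 0; 0, -1]] b :
      Matrix (Fin 2) (Fin 2) ℂ) B B'

/-- The inverse symbols `σ^b_{BB'}`; thus `∇_{BB'} = σ^b_{BB'} ∇_b`. -/
def ivdwInv (b : Fin 4) (B B' : Fin 2) : ℂ := conj (ivdw b B B')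

namespace SpinSpacetime

/-- The coefficients `γ_a^B_C` of the lift of the Levi-Civita connection to spinors,
`∇_a ξ^B = e_a(ξ^B) + γ_a^B_C ξ^C`, given by
`γ_a^B_C = ½ σ_b^{BA'} ω_a^b_c σ^c_{CA'}` (see `spinCoeff_lift`). -/
def spinCoeff (X : SpinSpacetime M) (a : Fin 4) (B C : Fin 2) (x : M) : ℂ :=
  (1 / 2) * ∑ A' : Fin 2, ∑ b : Fin 4, ∑ c : Fin 4,
    ivdw b B A' * (X.lcForm a b c x : ℂ) * ivdwInv c C A'

/-- The derivative `e_a(f)` of a complex function along a tetrad vector. -/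
def frameDeriv (X : SpinSpacetime M) (a : Fin 4) (f : M → ℂ) (x : M) : ℂ :=
  mfderiv 𝓘(ℝ, E4) 𝓘(ℝ, ℂ) f x (X.tetrad a x)

/-- The covariant derivative `∇_{AA'} φ_{B₁…B_k B'₁…B'_l}` of a spinor field. -/
def nabla (X : SpinSpacetime M) {k l : ℕ} (φ : SpinorField M k l) (A A' : Fin 2) :
    SpinorField M k l := fun B B' x =>
  ∑ a : Fin 4, ivdwInv a A A' *
    (X.frameDeriv a (φ B B') x
      - (∑ r : Fin k, ∑ C : Fin 2,
          X.spinCoeff a C (B r) x * φ (Function.update B r C) B' x)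
      - ∑ r : Fin l, ∑ C : Fin 2,
          conj (X.spinCoeff a C (B' r) x) * φ B (Function.update B' r C) x)

/-- `∇ ⊗ φ` as a two-block spinor, the first block carrying the indices of `∇_{AA'}`. -/
def nablaBlock (X : SpinSpacetime M) {k l : ℕ} (φ : SpinorField M k l)
    (A A' : Fin 1 → Fin 2) : SpinorField M k l :=
  X.nabla φ (A 0) (A' 0)

/-- The divergence `𝒟φ = ∇ ⊙^{1,1} φ` for `k, l ≥ 1` (and zero otherwise). -/
def fundD (X : SpinSpacetime M) : {k l : ℕ} → SpinorField M k l → SpinorField M (k - 1) (l - 1)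
  | _ + 1, _ + 1, φ => symContract (k := 0) (l := 0) 1 1 (X.nablaBlock φ)
  | 0, _, _ => 0
  | _ + 1, 0, _ => 0

/-- The curl `𝒞φ = ∇ ⊙^{0,1} φ` for `l ≥ 1` (and zero otherwise). -/
def fundC (X : SpinSpacetime M) : {k l : ℕ} → SpinorField M k l → SpinorField M (k + 1) (l - 1)
  | _, _ + 1, φ => symContract (k := 1) (l := 0) 0 1 (X.nablaBlock φ)
  | _, 0, _ => 0

/-- The curl-dagger `𝒞†φ = ∇ ⊙^{1,0} φ` for `k ≥ 1` (and zero otherwise). -/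
def fundCdag (X : SpinSpacetime M) :
    {k l : ℕ} → SpinorField M k l → SpinorField M (k - 1) (l + 1)
  | _ + 1, _, φ => symContract (k := 0) (l := 1) 1 0 (X.nablaBlock φ)
  | 0, _, _ => 0

/-- The twistor operator `𝒯φ = ∇ ⊙^{0,0} φ`. -/
def fundT (X : SpinSpacetime M) {k l : ℕ} (φ : SpinorField M k l) :
    SpinorField M (k + 1) (l + 1) :=
  symContract (k := 1) (l := 1) 0 0 (X.nablaBlock φ)

end SpinSpacetime

namespace SpinSpacetime

/-- `ω_{AA'} = ι^B ∇_{AA'} o_B`. -/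
def omega (X : SpinSpacetime M) (d : Dyad M) (A A' : Fin 2) (x : M) : ℂ :=
  ∑ B, d.iotaUp x B * X.nabla d.oField A A' ![B] ![] x

/-- The GHP connection `Θ_{AA'} = ∇_{AA'} - p ω_{AA'} - q ω̄_{AA'}` on fields of weight `{p,q}`;
here `ω̄_{AA'}` is the complex conjugate of `ω_{AA'}`, with components `conj ω_{A'A}`. -/
def theta (X : SpinSpacetime M) (d : Dyad M) (p q : ℤ) {k l : ℕ} (φ : SpinorField M k l)
    (A A' : Fin 2) : SpinorField M k l := fun B B' x =>
  X.nabla φ A A' B B' x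
    - ((p : ℂ) * X.omega d A A' x + (q : ℂ) * conj (X.omega d A' A x)) * φ B B' x

/-- `Θ_{AA'} f` for a scalar `f` of weight `{p,q}`. -/
def thetaScalar (X : SpinSpacetime M) (d : Dyad M) (p q : ℤ) (f : M → ℂ) (A A' : Fin 2)
    (x : M) : ℂ :=
  X.theta d p q (k := 0) (l := 0) (fun _ _ => f) A A' ![] ![] x

/-- `þ = o^A ō^{A'} Θ_{AA'}` on scalars of weight `{p,q}`. The four GHP operators are the
coefficients of the dyad expansion of `Θ_{AA'}`, see `thetaScalar_expansion`. -/
def tho (X : SpinSpacetime M) (d : Dyad M) (p q : ℤ) (f : M → ℂ) (x : M) : ℂ :=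
  ∑ A, ∑ A', d.oUp x A * conj (d.oUp x A') * X.thetaScalar d p q f A A' x

/-- `ð = o^A ῑ^{A'} Θ_{AA'}` on scalars of weight `{p,q}`. -/
def edt (X : SpinSpacetime M) (d : Dyad M) (p q : ℤ) (f : M → ℂ) (x : M) : ℂ :=
  ∑ A, ∑ A', d.oUp x A * conj (d.iotaUp x A') * X.thetaScalar d p q f A A' x

/-- `ð' = ι^A ō^{A'} Θ_{AA'}` on scalars of weight `{p,q}`. -/
def edt' (X : SpinSpacetime M) (d : Dyad M) (p q : ℤ) (f : M → ℂ) (x : M) : ℂ :=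
  ∑ A, ∑ A', d.iotaUp x A * conj (d.oUp x A') * X.thetaScalar d p q f A A' x

/-- `þ' = ι^A ῑ^{A'} Θ_{AA'}` on scalars of weight `{p,q}`. -/
def tho' (X : SpinSpacetime M) (d : Dyad M) (p q : ℤ) (f : M → ℂ) (x : M) : ℂ :=
  ∑ A, ∑ A', d.iotaUp x A * conj (d.iotaUp x A') * X.thetaScalar d p q f A A' x

/-- `Γ_{AA'} = -o^B Θ_{AA'} o_B`, so that `Θ_{AA'} o_B = Γ_{AA'} ι_B`, see `theta_o`
(`o_B` has weight `{1,0}`). -/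
def Gam (X : SpinSpacetime M) (d : Dyad M) (A A' : Fin 2) (x : M) : ℂ :=
  -∑ B, d.oUp x B * X.theta d 1 0 d.oField A A' ![B] ![] x

/-- `Γ'_{AA'} = ι^B Θ_{AA'} ι_B`, so that `Θ_{AA'} ι_B = Γ'_{AA'} o_B`, see `theta_iota`
(`ι_B` has weight `{-1,0}`). -/
def Gam' (X : SpinSpacetime M) (d : Dyad M) (A A' : Fin 2) (x : M) : ℂ :=
  ∑ B, d.iotaUp x B * X.theta d (-1) 0 d.iotaField A A' ![B] ![] x

/-! The spin coefficients are the coefficients of the dyad expansions of `Γ_{AA'}` and `Γ'_{AA'}`,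
see `Gam_expansion` and `Gam'_expansion`. -/

/-- `κ` -/
def kappa (X : SpinSpacetime M) (d : Dyad M) (x : M) : ℂ :=
  -∑ A, ∑ A', d.oUp x A * conj (d.oUp x A') * X.Gam d A A' x

/-- `σ` -/
def sigma (X : SpinSpacetime M) (d : Dyad M) (x : M) : ℂ :=
  -∑ A, ∑ A', d.oUp x A * conj (d.iotaUp x A') * X.Gam d A A' x

/-- `ρ` -/
def rho (X : SpinSpacetime M) (d : Dyad M) (x : M) : ℂ :=
  -∑ A, ∑ A', d.iotaUp x A * conj (d.oUp x A') * X.Gam d A A' x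

/-- `τ` -/
def tau (X : SpinSpacetime M) (d : Dyad M) (x : M) : ℂ :=
  -∑ A, ∑ A', d.iotaUp x A * conj (d.iotaUp x A') * X.Gam d A A' x

/-- `τ'` -/
def tau' (X : SpinSpacetime M) (d : Dyad M) (x : M) : ℂ :=
  -∑ A, ∑ A', d.oUp x A * conj (d.oUp x A') * X.Gam' d A A' x

/-- `ρ'` -/
def rho' (X : SpinSpacetime M) (d : Dyad M) (x : M) : ℂ :=
  -∑ A, ∑ A', d.oUp x A * conj (d.iotaUp x A') * X.Gam' d A A' x

/-- `σ'` -/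
def sigma' (X : SpinSpacetime M) (d : Dyad M) (x : M) : ℂ :=
  -∑ A, ∑ A', d.iotaUp x A * conj (d.oUp x A') * X.Gam' d A A' x

/-- `κ'` -/
def kappa' (X : SpinSpacetime M) (d : Dyad M) (x : M) : ℂ :=
  -∑ A, ∑ A', d.iotaUp x A * conj (d.iotaUp x A') * X.Gam' d A A' x

/-! ### Checks: the definitions above satisfy the defining relations -/

set_option maxHeartbeats 4000000 in
/-- `∇_a` on spinors is the lift of the Levi-Civita connection: on the spinor components
`V^{BB'}` of a vector it induces `∇_a V^b = e_a(V^b) + ω_a^b_c V^c`. -/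
theorem spinCoeff_lift (X : SpinSpacetime M) (a : Fin 4) (B B' C C' : Fin 2) (x : M) :
    ∑ b : Fin 4, ∑ c : Fin 4, ivdw b B B' * (X.lcForm a b c x : ℂ) * ivdwInv c C C' =
      X.spinCoeff a B C x * (if B' = C' then 1 else 0) +
        (if B = C then 1 else 0) * conj (X.spinCoeff a B' C' x) := by
  have h2 : ((Real.sqrt 2 : ℝ) : ℂ) ^ 2 = 2 := by
    rw [← Complex.ofReal_pow, Real.sq_sqrt (by norm_num)]; norm_num
  have hs : ((Real.sqrt 2 : ℝ) : ℂ)⁻¹ * ((Real.sqrt 2 : ℝ) : ℂ)⁻¹ = 1 / 2 := by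
    rw [← mul_inv, ← sq, h2]; norm_num
  have hd : ∀ b, X.lcCoeff a b b x = 0 := fun b => by
    have := X.lcCoeff_antisymm a b b x; linarith
  have h10 := X.lcCoeff_antisymm a 1 0 x
  have h20 := X.lcCoeff_antisymm a 2 0 x
  have h30 := X.lcCoeff_antisymm a 3 0 x
  have h21 := X.lcCoeff_antisymm a 2 1 x
  have h31 := X.lcCoeff_antisymm a 3 1 x
  have h32 := X.lcCoeff_antisymm a 3 2 x
  have hI : Complex.I * Complex.I = -1 := Complex.I_mul_I
  have key : ∀ u v w : ℂ, ((Real.sqrt 2 : ℝ) : ℂ)⁻¹ * u * w * (((Real.sqrt 2 : ℝ) : ℂ)⁻¹ * v) =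
      1 / 2 * (u * w * v) := fun u v w => by
    rw [← hs]; ring
  simp only [spinCoeff, ivdwInv, ivdw, map_mul, map_inv₀, Complex.conj_ofReal, map_sum, key,
    Complex.conj_conj, map_div₀, map_one, map_ofNat]
  fin_cases B <;> fin_cases B' <;> fin_cases C <;> fin_cases C' <;>
  · simp [Fin.sum_univ_four, Fin.sum_univ_two, lcForm, minkowski, hd, h10, h20, h30, h21, h31, h32]
    try ring_nf

/-- `∇_{AA'} ε_{BC} = 0`: the spin connection is trace-free. -/
theorem spinCoeff_trace (X : SpinSpacetime M) (a : Fin 4) (x : M) :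
    ∑ B, X.spinCoeff a B B x = 0 := by
  have hd : ∀ b, X.lcCoeff a b b x = 0 := fun b => by
    have := X.lcCoeff_antisymm a b b x; linarith
  have h10 := X.lcCoeff_antisymm a 1 0 x
  have h20 := X.lcCoeff_antisymm a 2 0 x
  have h30 := X.lcCoeff_antisymm a 3 0 x
  have h21 := X.lcCoeff_antisymm a 2 1 x
  have h31 := X.lcCoeff_antisymm a 3 1 x
  have h32 := X.lcCoeff_antisymm a 3 2 x
  simp only [spinCoeff, ivdwInv, ivdw, map_mul, map_inv₀, Complex.conj_ofReal]
  simp [Fin.sum_univ_four, Fin.sum_univ_two, lcForm, minkowski, hd, h10, h20, h30, h21, h31, h32]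
  try ring_nf

/-- `o^B ∇_{AA'} ι_B = ι^B ∇_{AA'} o_B`. -/
theorem omega_symm (X : SpinSpacetime M) (d : Dyad M) (A A' : Fin 2) (x : M) :
    ∑ B, d.oUp x B * X.nabla d.iotaField A A' ![B] ![] x = X.omega d A A' x := by
  have hdiff : ∀ f : M → ℂ, ContMDiff 𝓘(ℝ, E4) 𝓘(ℝ, ℂ) ∞ f →
      MDifferentiableAt 𝓘(ℝ, E4) 𝓘(ℝ, ℂ) f x := fun f hf => (hf x).mdifferentiableAt (by simp)
  have key : ∀ a, d.o 0 x * X.frameDeriv a (d.iota 1) x + d.iota 1 x * X.frameDeriv a (d.o 0) x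
      - (d.o 1 x * X.frameDeriv a (d.iota 0) x + d.iota 0 x * X.frameDeriv a (d.o 1) x) = 0 := by
    intro a
    have h : (fun y => d.o 0 y * d.iota 1 y - d.o 1 y * d.iota 0 y) = fun _ => (1 : ℂ) := by
      funext y
      have h := d.normalized y
      simp [raise, eps, Fin.sum_univ_two] at h
      linear_combination h
    have h1 := ((hdiff _ (d.o_smooth 0)).hasMFDerivAt.mul
      (hdiff _ (d.iota_smooth 1)).hasMFDerivAt).sub
      ((hdiff _ (d.o_smooth 1)).hasMFDerivAt.mul (hdiff _ (d.iota_smooth 0)).hasMFDerivAt)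
    have h2 := hasMFDerivAt_const (I := 𝓘(ℝ, E4)) (I' := 𝓘(ℝ, ℂ)) (1 : ℂ) x
    rw [← h] at h2
    exact congrArg (fun L => L (X.tetrad a x)) (hasMFDerivAt_unique h1 h2)
  have ht := fun a => X.spinCoeff_trace a x
  simp only [omega, nabla, Dyad.oUp, Dyad.iotaUp, raise, eps, Fin.sum_univ_two] at ht ⊢
  simp [Dyad.oField, Dyad.iotaField]
  rw [← sub_eq_zero]
  simp only [Finset.mul_sum, ← Finset.sum_add_distrib, ← Finset.sum_neg_distrib,
    ← Finset.sum_sub_distrib]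
  refine Finset.sum_eq_zero fun a _ => ?_
  linear_combination -(ivdwInv a A A') * key a +
    ivdwInv a A A' * (d.o 0 x * d.iota 1 x - d.o 1 x * d.iota 0 x) * ht a

/-- `Θ_{AA'} = ι_A ῑ_{A'} þ - ι_A ō_{A'} ð - o_A ῑ_{A'} ð' + o_A ō_{A'} þ'`. -/
theorem thetaScalar_expansion (X : SpinSpacetime M) (d : Dyad M) (p q : ℤ) (f : M → ℂ)
    (A A' : Fin 2) (x : M) :
    X.thetaScalar d p q f A A' x =
      d.iota A x * conj (d.iota A' x) * X.tho d p q f x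
      - d.iota A x * conj (d.o A' x) * X.edt d p q f x
      - d.o A x * conj (d.iota A' x) * X.edt' d p q f x
      + d.o A x * conj (d.o A' x) * X.tho' d p q f x :=
  d.expansion x (fun A A' => X.thetaScalar d p q f A A' x) A A'

theorem theta_o (X : SpinSpacetime M) (d : Dyad M) (A A' B : Fin 2) (x : M) :
    X.theta d 1 0 d.oField A A' ![B] ![] x = X.Gam d A A' x * d.iota B x := by
  rw [d.expansion_one x (fun B => X.theta d 1 0 d.oField A A' ![B] ![] x) B]
  have h := d.contr x
  have h0 : ∑ B, d.iotaUp x B * X.theta d 1 0 d.oField A A' ![B] ![] x = 0 := by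
    have h1 : ∑ B, d.iotaUp x B * X.nabla d.oField A A' ![B] ![] x = X.omega d A A' x := rfl
    simp only [theta, Fin.sum_univ_two] at h h1 ⊢
    simp [Dyad.oField] at h1 ⊢
    linear_combination h1 - (X.omega d A A' x) * h
  rw [h0, Gam]
  ring

theorem theta_iota (X : SpinSpacetime M) (d : Dyad M) (A A' B : Fin 2) (x : M) :
    X.theta d (-1) 0 d.iotaField A A' ![B] ![] x = X.Gam' d A A' x * d.o B x := by
  rw [d.expansion_one x (fun B => X.theta d (-1) 0 d.iotaField A A' ![B] ![] x) B]
  have h := d.contr' x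
  have h1 := X.omega_symm d A A' x
  have h0 : ∑ B, d.oUp x B * X.theta d (-1) 0 d.iotaField A A' ![B] ![] x = 0 := by
    simp only [theta, Fin.sum_univ_two] at h h1 ⊢
    simp [Dyad.iotaField] at h1 ⊢
    linear_combination h1 + (X.omega d A A' x) * h
  rw [h0, Gam']
  ring

theorem Gam_expansion (X : SpinSpacetime M) (d : Dyad M) (A A' : Fin 2) (x : M) :
    X.Gam d A A' x =
      -(d.iota A x * conj (d.iota A' x) * X.kappa d x)
      + d.iota A x * conj (d.o A' x) * X.sigma d x
      + d.o A x * conj (d.iota A' x) * X.rho d x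
      - d.o A x * conj (d.o A' x) * X.tau d x := by
  rw [d.expansion x (fun A A' => X.Gam d A A' x) A A', kappa, sigma, rho, tau]
  ring

theorem Gam'_expansion (X : SpinSpacetime M) (d : Dyad M) (A A' : Fin 2) (x : M) :
    X.Gam' d A A' x =
      -(d.iota A x * conj (d.iota A' x) * X.tau' d x)
      + d.iota A x * conj (d.o A' x) * X.rho' d x
      + d.o A x * conj (d.iota A' x) * X.sigma' d x
      - d.o A x * conj (d.o A' x) * X.kappa' d x := by
  rw [d.expansion x (fun A A' => X.Gam' d A A' x) A A', kappa', sigma', rho', tau']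
  ring

end SpinSpacetime

end Operators

end GHP

end

noncomputable section

namespace GHP

/-! A component of a symmetric spinor along `o^A`, `ι^A` and their conjugates depends only on the
number `i` of factors `ι` and the number `j` of factors `ῑ`. The scalar `φ_{ij'}`, defined by
contraction with a symmetrized basis spinor, is therefore any dyad component with these numbers
(`Dyad.comp_eq_dyadComp`).

The analytic input is the Leibniz rule in the moving dyad. Since `∇o = ω o + Γ ι` and `∇ι = -ω ι +
Γ' o`, a dyad component of `∇_{AA'} φ` is the derivative of `φ_{ij'}` minus one correction for each
index. The `k - i` indices along `o` and the `i` indices along `ι` together contribute `(k - 2i) ω`,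
the primed ones `(l - 2j) ω̄`; this is exactly what turns `∇` into `Θ` at weight `{k-2i, l-2j}`. The
off-diagonal parts move `i` or `j` by one: `Γ` with the factor `k - i`, `Γ'` with `i`, and likewise
for the conjugates. This is `dyadComp_nabla_eq_thetaScalar`. Contracting `A` and `A'` with the dyad
then produces the GHP operators and the spin coefficients (`nablaComp_zero_zero` and its three
companions).

What remains is algebra. A contraction is a signed sum of two dyad components because `ε^{BC} = o^B
ι^C - ι^B o^C`. A symmetrization is an average over permutations; an unprimed derivative index in an
uncontracted slot meets `o` in the proportion `(k+1-i)/(k+1)` and `ι` in the proportion `i/(k+1)`,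
and similarly for a primed one. Hence each fundamental operator has components that are explicit
combinations of the components of `∇φ` (`comp_fundD`, `comp_fundC`, `comp_fundCdag`, `comp_fundT`),
and collecting terms gives the four formulas. -/

/-- The component along the frame vectors `w (b 0), w (b 1), …` of a tensor `T` with `n` lower
two-dimensional indices. -/
def frameComp {n : ℕ} (w : Fin 2 → Fin 2 → ℂ) (b : Fin n → Fin 2) (T : (Fin n → Fin 2) → ℂ) : ℂ :=
  ∑ A : Fin n → Fin 2, (∏ r, w (b r) (A r)) * T A

/-- The number of indices in `b` which are equal to `1`. -/
def numOnes {n : ℕ} (b : Fin n → Fin 2) : ℤ := ∑ r, ((b r : ℕ) : ℤ)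

/-! ### Tensor components in a two-dimensional frame -/

section FrameComp

variable {n : ℕ} (w : Fin 2 → Fin 2 → ℂ)

theorem frameComp_sum {ι : Type*} (s : Finset ι) (b : Fin n → Fin 2)
    (T : ι → (Fin n → Fin 2) → ℂ) :
    frameComp w b (fun A => ∑ i ∈ s, T i A) = ∑ i ∈ s, frameComp w b (T i) := by
  simp only [frameComp, Finset.mul_sum]
  exact Finset.sum_comm

theorem frameComp_mul (c : ℂ) (b : Fin n → Fin 2) (T : (Fin n → Fin 2) → ℂ) :
    frameComp w b (fun A => c * T A) = c * frameComp w b T := by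
  simp only [frameComp, Finset.mul_sum]
  exact Finset.sum_congr rfl fun A _ => by ring

theorem frameComp_sub (b : Fin n → Fin 2) (S T : (Fin n → Fin 2) → ℂ) :
    frameComp w b (fun A => S A - T A) = frameComp w b S - frameComp w b T := by
  simp only [frameComp, mul_sub, Finset.sum_sub_distrib]

theorem frameComp_comp_perm (s : Equiv.Perm (Fin n)) (b : Fin n → Fin 2)
    (T : (Fin n → Fin 2) → ℂ) :
    frameComp w b (fun A => T (A ∘ s)) = frameComp w (b ∘ s) T := by
  unfold frameComp
  refine Fintype.sum_equiv (s.arrowCongr (Equiv.refl (Fin 2))).symm _ _ fun A => ?_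
  have h : (s.arrowCongr (Equiv.refl (Fin 2))).symm A = A ∘ s := rfl
  rw [h, ← Equiv.prod_comp s]
  rfl

/-- The components of a contraction `ε^{BC} T_{C…B}`. -/
theorem frameComp_contract (hw : ∀ B C, ∑ b, ∑ c, eps b c * w b B * w c C = eps B C)
    (a : Fin n → Fin 2) (T : Fin 2 → (Fin (n + 1) → Fin 2) → ℂ) :
    frameComp w a (fun A => ∑ B, ∑ C, eps B C * T C (Fin.snoc A B)) =
      ∑ b, ∑ c, eps b c * ∑ C, w c C * frameComp w (Fin.snoc a b) (T C) := by
  have hs : ∀ b C, frameComp w (Fin.snoc a b : Fin (n + 1) → Fin 2) (T C) =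
      ∑ B, ∑ A : Fin n → Fin 2, (∏ r, w (a r) (A r)) * w b B * T C (Fin.snoc A B) := by
    intro b C
    rw [frameComp, ← Fintype.sum_prod_type']
    refine (Fintype.sum_equiv (Fin.snocEquiv fun _ : Fin (n + 1) => Fin 2) _ _ fun p => ?_).symm
    simp [Fin.prod_univ_castSucc, Fin.snocEquiv]
  -- The contraction is carried into the frame by expanding `ε^{BC}` in the frame vectors.
  have h : ∀ A : Fin n → Fin 2, ∑ B, ∑ C, eps B C * T C (Fin.snoc A B) =
      ∑ B, ∑ C, (∑ b, ∑ c, eps b c * w b B * w c C) * T C (Fin.snoc A B) := fun A => by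
    simp only [hw]
  simp only [h, hs]
  simp only [frameComp, Fin.sum_univ_two, Finset.mul_sum, ← Finset.sum_add_distrib]
  refine Finset.sum_congr rfl fun A _ => ?_
  ring

/-- The components of a product `T_{A_n A_0 … A_{n-1}}`. -/
theorem frameComp_prepend (a : Fin (n + 1) → Fin 2) (T : Fin 2 → (Fin n → Fin 2) → ℂ) :
    frameComp w a (fun A => T (A (Fin.last n)) fun r => A r.castSucc) =
      ∑ C, w (a (Fin.last n)) C * frameComp w (fun r => a r.castSucc) (T C) := by
  simp only [frameComp, Finset.mul_sum]
  rw [← Fintype.sum_prod_type']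
  refine (Fintype.sum_equiv (Fin.snocEquiv fun _ : Fin (n + 1) => Fin 2) _ _ fun p => ?_).symm
  simp [Fin.prod_univ_castSucc, Fin.snocEquiv]
  ring

theorem prod_update_left (b A : Fin n → Fin 2) (r : Fin n) (c : Fin 2) :
    ∏ s, w (Function.update b r c s) (A s) =
      w c (A r) * ∏ s ∈ Finset.univ.erase r, w (b s) (A s) := by
  rw [← Finset.mul_prod_erase _ _ (Finset.mem_univ r), Function.update_self]
  congr 1
  refine Finset.prod_congr rfl fun s hs => ?_
  rw [Function.update_of_ne (Finset.ne_of_mem_erase hs)]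

/-- This is summation by parts for one index: the connection matrix acting on slot `r` of `T` is
transferred to the frame vector `w (b r)` contracted with that slot. -/
theorem sum_prod_mul_update (G : Fin 2 → Fin 2 → ℂ) (b : Fin n → Fin 2)
    (T : (Fin n → Fin 2) → ℂ) (r : Fin n) :
    ∑ A : Fin n → Fin 2, (∏ s, w (b s) (A s)) *
        ∑ C, G C (A r) * T (Function.update A r C) =
      ∑ A : Fin n → Fin 2, (∏ s ∈ Finset.univ.erase r, w (b s) (A s)) *
        (∑ B, G (A r) B * w (b r) B) * T A := by
  -- Exchanging the summed index `C` with the entry `A r` is an involution of the pairs `(A, C)`,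
  -- and it interchanges the two sides.
  have hinv : Function.Involutive
      (fun p : (Fin n → Fin 2) × Fin 2 => (Function.update p.1 r p.2, p.1 r)) := fun p => by simp
  simp only [Finset.mul_sum, Finset.sum_mul]
  rw [← Fintype.sum_prod_type', ← Fintype.sum_prod_type']
  refine Fintype.sum_equiv hinv.toPerm _ _ fun p => ?_
  simp only [Function.Involutive.coe_toPerm, Function.update_self]
  rw [← Finset.mul_prod_erase _ _ (Finset.mem_univ r)]
  have h : ∏ s ∈ Finset.univ.erase r, w (b s) (Function.update p.1 r p.2 s) =
      ∏ s ∈ Finset.univ.erase r, w (b s) (p.1 s) :=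
    Finset.prod_congr rfl fun s hs => by
      rw [Function.update_of_ne (Finset.ne_of_mem_erase hs)]
  rw [h]
  ring

end FrameComp

/-! ### Counting ones in multi-indices and averaging over permutations -/

section NumOnes

variable {n : ℕ}

theorem numOnes_comp_perm (s : Equiv.Perm (Fin n)) (b : Fin n → Fin 2) :
    numOnes (b ∘ s) = numOnes b :=
  Equiv.sum_comp s fun r => ((b r : ℕ) : ℤ)

theorem numOnes_snoc (a : Fin n → Fin 2) (b : Fin 2) :
    numOnes (Fin.snoc a b : Fin (n + 1) → Fin 2) = numOnes a + ((b : ℕ) : ℤ) := by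
  simp [numOnes, Fin.sum_univ_castSucc]

theorem numOnes_castSucc (a : Fin (n + 1) → Fin 2) :
    numOnes (fun r => a r.castSucc) = numOnes a - ((a (Fin.last n) : ℕ) : ℤ) := by
  simp [numOnes, Fin.sum_univ_castSucc]

theorem numOnes_update (b : Fin n → Fin 2) (r : Fin n) (c : Fin 2) :
    numOnes (Function.update b r c) = numOnes b - ((b r : ℕ) : ℤ) + ((c : ℕ) : ℤ) := by
  unfold numOnes
  rw [← Finset.add_sum_erase _ _ (Finset.mem_univ r),
    ← Finset.add_sum_erase _ (fun s => ((b s : ℕ) : ℤ)) (Finset.mem_univ r), Function.update_self]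
  have h : ∑ s ∈ Finset.univ.erase r, ((Function.update b r c s : ℕ) : ℤ) =
      ∑ s ∈ Finset.univ.erase r, ((b s : ℕ) : ℤ) :=
    Finset.sum_congr rfl fun s hs => by
      rw [Function.update_of_ne (Finset.ne_of_mem_erase hs)]
  rw [h]
  ring

theorem numOnes_nonneg (b : Fin n → Fin 2) : 0 ≤ numOnes b :=
  Finset.sum_nonneg fun _ _ => by positivity

theorem numOnes_le (b : Fin n → Fin 2) : numOnes b ≤ n := by
  have h : numOnes b ≤ ∑ _r : Fin n, (1 : ℤ) := Finset.sum_le_sum fun r _ => by omega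
  simpa using h

/-- A function on `{0, 1}` summed along `b`. -/
theorem sum_comp_eq (b : Fin n → Fin 2) (F : Fin 2 → ℂ) :
    ∑ r, F (b r) = ((n : ℂ) - numOnes b) * F 0 + numOnes b * F 1 := by
  -- Every function on two points is affine, so only the sum of the entries of `b` matters.
  have h : ∀ c : Fin 2, F c = F 0 + ((c : ℕ) : ℂ) * (F 1 - F 0) := fun c => by
    fin_cases c <;> simp
  rw [Finset.sum_congr rfl fun r _ => h (b r), Finset.sum_add_distrib, ← Finset.sum_mul]
  simp [numOnes]
  ring

/-- Two multi-indices with equally many ones differ by a permutation. -/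
theorem exists_perm_of_numOnes_eq {a b : Fin n → Fin 2} (h : numOnes a = numOnes b) :
    ∃ s : Equiv.Perm (Fin n), a ∘ s = b := by
  have hcard : ∀ a : Fin n → Fin 2, (Fintype.card {r // a r = 1} : ℤ) = numOnes a := by
    intro a
    rw [Fintype.card_subtype, numOnes, Finset.card_filter]
    push_cast
    refine Finset.sum_congr rfl fun r _ => ?_
    generalize a r = c
    fin_cases c <;> simp
  have e1 : Fintype.card {r // b r = 1} = Fintype.card {r // a r = 1} := by
    have := hcard a; have := hcard b; omega
  -- A bijection between the positions of the ones extends to a permutation, which necessarily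
  -- matches the zeros as well.
  let e : {r // b r = 1} ≃ {r // a r = 1} := Fintype.equivOfCardEq e1
  refine ⟨e.extendSubtype, funext fun r => ?_⟩
  by_cases hr : b r = 1
  · simpa [hr] using e.extendSubtype_mem r hr
  · have := e.extendSubtype_not_mem r hr
    simp only [Function.comp]
    omega

theorem sum_perm_apply (r₀ : Fin (n + 1)) (F : Fin (n + 1) → ℂ) :
    ∑ s : Equiv.Perm (Fin (n + 1)), F (s r₀) = n.factorial * ∑ r, F r := by
  -- Right multiplication by a transposition moves `r₀` to `0`. `decomposeFin` then splits a
  -- permutation into its value at `0` and a permutation of the rest, so each value occurs `n!`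
  -- times.
  rw [← Equiv.sum_comp (Equiv.mulRight (Equiv.swap 0 r₀))]
  simp only [Equiv.coe_mulRight, Equiv.Perm.mul_apply, Equiv.swap_apply_right]
  rw [← Equiv.sum_comp Equiv.Perm.decomposeFin.symm, Fintype.sum_prod_type]
  simp [Fintype.card_perm, Finset.mul_sum]

/-- The average over all permutations of a function of one of the indices. -/
theorem average_perm (r₀ : Fin (n + 1)) (a : Fin (n + 1) → Fin 2) (F : Fin 2 → ℂ) :
    ((n + 1).factorial : ℂ)⁻¹ * ∑ s : Equiv.Perm (Fin (n + 1)), F (a (s r₀)) =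
      (((n : ℂ) + 1 - numOnes a) * F 0 + numOnes a * F 1) / (n + 1) := by
  rw [sum_perm_apply r₀ fun r => F (a r), sum_comp_eq a F, Nat.factorial_succ]
  have h1 : (n.factorial : ℂ) ≠ 0 := Nat.cast_ne_zero.2 n.factorial_ne_zero
  have h2 : (n : ℂ) + 1 ≠ 0 := Nat.cast_add_one_ne_zero n
  push_cast
  field_simp

end NumOnes

/-! ### Raising indices with ε, standard multi-indices and symmetrization -/

theorem conj_eps (A B : Fin 2) : conj (eps A B) = eps A B := by
  fin_cases A <;> fin_cases B <;> simp [eps]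

theorem sum_sum_comm {α β γ δ : Type*} [Fintype α] [Fintype β] [Fintype γ] [Fintype δ]
    (f : α → β → γ → δ → ℂ) :
    ∑ a, ∑ b, ∑ c, ∑ e, f a b c e = ∑ c, ∑ e, ∑ a, ∑ b, f a b c e := by
  have h := Finset.sum_comm (s := Finset.univ) (t := Finset.univ)
    (f := fun (p : α × β) (q : γ × δ) => f p.1 p.2 q.1 q.2)
  simpa only [Fintype.sum_prod_type] using h

theorem sum_eps_mul_prod {n : ℕ} (v : Fin 2 → Fin 2 → ℂ) (a : Fin n → Fin 2)
    (s : Equiv.Perm (Fin n)) (B : Fin n → Fin 2) :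
    ∑ C : Fin n → Fin 2, (∏ r, eps (B r) (C r)) * ∏ r, v (a r) (C (s r)) =
      ∏ r, ∑ c, eps (B r) c * v (a (s⁻¹ r)) c := by
  rw [Finset.prod_univ_sum, Fintype.piFinset_univ]
  refine Finset.sum_congr rfl fun C _ => ?_
  rw [Finset.prod_mul_distrib, ← Equiv.prod_comp s fun r => v (a (s⁻¹ r)) (C r)]
  simp

/-- The multi-index whose first `m` indices are `0` and whose other indices are `1`. -/
def stdIndex (m n : ℕ) : Fin n → Fin 2 := fun r => if (r : ℕ) < m then 0 else 1

theorem numOnes_stdIndex {n : ℕ} {i : ℤ} (h0 : 0 ≤ i) (h1 : i ≤ n) :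
    numOnes (stdIndex ((n : ℤ) - i).toNat n) = i := by
  obtain ⟨m, rfl⟩ : ∃ m : ℕ, i = (n : ℤ) - m := ⟨((n : ℤ) - i).toNat, by omega⟩
  have hm : m ≤ n := by omega
  have e : ∀ r : Fin n, ((stdIndex m n r : ℕ) : ℤ) = 1 - if (r : ℕ) < m then 1 else 0 := by
    intro r
    by_cases h : (r : ℕ) < m <;> simp [stdIndex, h]
  simp only [sub_sub_cancel, Int.toNat_natCast, numOnes, e, Finset.sum_sub_distrib]
  rw [Fin.sum_univ_eq_sum_range (fun r => if r < m then (1 : ℤ) else 0), ← Finset.sum_filter]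
  have hf : Finset.filter (fun r => r < m) (Finset.range n) = Finset.range m := by
    ext r; simp; omega
  simp [hf]

theorem average_const {k l : ℕ} (c : ℂ) :
    ((k.factorial : ℂ) * (l.factorial : ℂ))⁻¹ *
      ∑ _s : Equiv.Perm (Fin k), ∑ _t : Equiv.Perm (Fin l), c = c := by
  have h1 : (k.factorial : ℂ) ≠ 0 := Nat.cast_ne_zero.2 k.factorial_ne_zero
  have h2 : (l.factorial : ℂ) ≠ 0 := Nat.cast_ne_zero.2 l.factorial_ne_zero
  simp [Fintype.card_perm]
  field_simp

theorem symmetrize_symm {M : Type*} {k l : ℕ} (T : SpinorField M k l)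
    (s : Equiv.Perm (Fin k)) (t : Equiv.Perm (Fin l)) (A : Fin k → Fin 2) (A' : Fin l → Fin 2) :
    symmetrize T (A ∘ s) (A' ∘ t) = symmetrize T A A' := by
  funext x
  unfold symmetrize
  congr 1
  exact Fintype.sum_equiv (Equiv.mulLeft s) _ _ fun s' =>
    Fintype.sum_equiv (Equiv.mulLeft t) _ _ fun t' => rfl

/-! ### The scalars `φ_{ij'}` as dyad components -/

section

variable {M : Type*} [TopologicalSpace M] [ChartedSpace E4 M]

namespace Dyad

/-- The dyad `o_A, ι_A` as a family indexed by `0, 1`. -/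
def lower (d : Dyad M) (x : M) (c C : Fin 2) : ℂ := if c = 0 then d.o C x else d.iota C x

/-- The dyad `o^A, ι^A` as a family indexed by `0, 1`. -/
def upper (d : Dyad M) (x : M) (c C : Fin 2) : ℂ := if c = 0 then d.oUp x C else d.iotaUp x C

/-- The complex conjugate of the dyad `o^A, ι^A`. -/
def upperConj (d : Dyad M) (x : M) (c C : Fin 2) : ℂ := conj (d.upper x c C)

/-- The components of a spinor field along the dyad. -/
def dyadComp (d : Dyad M) {k l : ℕ} (φ : SpinorField M k l) (b : Fin k → Fin 2)
    (b' : Fin l → Fin 2) (x : M) : ℂ :=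
  frameComp (d.upper x) b fun A => frameComp (d.upperConj x) b' fun A' => φ A A' x

theorem sum_eps_lower (d : Dyad M) (x : M) (c B : Fin 2) :
    ∑ C, eps B C * d.lower x c C = d.upper x c B := by
  fin_cases c <;> simp [lower, upper, oUp, iotaUp, raise]

theorem sum_eps_lower_conj (d : Dyad M) (x : M) (c B : Fin 2) :
    ∑ C, eps B C * conj (d.lower x c C) = d.upperConj x c B := by
  rw [upperConj, ← sum_eps_lower, map_sum]
  simp only [map_mul, conj_eps]

/-- The matrix of a normalized dyad has determinant one and so preserves the symplectic form. This
is the hypothesis needed by `frameComp_contract`. -/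
theorem eps_upper (d : Dyad M) (x : M) (B C : Fin 2) :
    ∑ b, ∑ c, eps b c * d.upper x b B * d.upper x c C = eps B C := by
  have h := d.normalized x
  simp [raise, eps, Fin.sum_univ_two] at h
  fin_cases B <;> fin_cases C <;>
    simp [upper, oUp, iotaUp, raise, eps] <;>
    first | ring1 | linear_combination h | linear_combination -h

theorem eps_upperConj (d : Dyad M) (x : M) (B C : Fin 2) :
    ∑ b, ∑ c, eps b c * d.upperConj x b B * d.upperConj x c C = eps B C := by
  rw [← conj_eps B C, ← d.eps_upper x]
  simp only [upperConj, map_sum, map_mul, conj_eps]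

theorem basis_eq (d : Dyad M) (n k m l : ℕ) (C : Fin k → Fin 2) (C' : Fin l → Fin 2) (x : M) :
    d.basis n k m l C C' x = ((k.factorial : ℂ) * (l.factorial : ℂ))⁻¹ *
      ∑ s : Equiv.Perm (Fin k), ∑ t : Equiv.Perm (Fin l),
        (∏ r, d.lower x (stdIndex n k r) (C (s r))) *
          ∏ r, conj (d.lower x (stdIndex m l r) (C' (t r))) := by
  have h : ∀ (p : Prop) [Decidable p] (A : Fin 2),
      d.lower x (if p then 0 else 1) A = if p then d.o A x else d.iota A x := by
    intro p _ A
    by_cases hp : p <;> simp [lower, hp]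
  have h' : ∀ (p : Prop) [Decidable p] (A : Fin 2),
      conj (d.lower x (if p then 0 else 1) A) =
        if p then conj (d.o A x) else conj (d.iota A x) := by
    intro p _ A
    by_cases hp : p <;> simp [lower, hp]
  simp only [basis, symmetrize, stdIndex, h', Function.comp]
  simp only [h]

/-- Raising acts on each factor of the symmetrized product separately, so the raised basis spinor is
the average of products of `o^A`, `ι^A` and their conjugates. -/
theorem sum_eps_basis (d : Dyad M) (n k m l : ℕ) (B : Fin k → Fin 2) (B' : Fin l → Fin 2)
    (x : M) :
    ∑ C : Fin k → Fin 2, ∑ C' : Fin l → Fin 2,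
      (∏ r, eps (B r) (C r)) * (∏ r, eps (B' r) (C' r)) * d.basis n k m l C C' x =
    ((k.factorial : ℂ) * (l.factorial : ℂ))⁻¹ *
      ∑ s : Equiv.Perm (Fin k), ∑ t : Equiv.Perm (Fin l),
        (∏ r, d.upper x (stdIndex n k (s r)) (B r)) *
          ∏ r, d.upperConj x (stdIndex m l (t r)) (B' r) := by
  have h1 : ∀ s : Equiv.Perm (Fin k), ∑ C : Fin k → Fin 2,
      (∏ r, eps (B r) (C r)) * ∏ r, d.lower x (stdIndex n k r) (C (s r)) =
        ∏ r, d.upper x (stdIndex n k (s⁻¹ r)) (B r) := fun s => by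
    rw [sum_eps_mul_prod]
    simp only [sum_eps_lower]
  have h2 : ∀ t : Equiv.Perm (Fin l), ∑ C : Fin l → Fin 2,
      (∏ r, eps (B' r) (C r)) * ∏ r, conj (d.lower x (stdIndex m l r) (C (t r))) =
        ∏ r, d.upperConj x (stdIndex m l (t⁻¹ r)) (B' r) := fun t => by
    rw [sum_eps_mul_prod fun c C => conj (d.lower x c C)]
    simp only [sum_eps_lower_conj]
  -- Moving a permutation from the spinor indices to the dyad labels inverts it; summing over
  -- inverses compensates.
  rw [← Equiv.sum_comp (Equiv.inv (Equiv.Perm (Fin k)))]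
  have h3 : ∀ s : Equiv.Perm (Fin k), ∑ t : Equiv.Perm (Fin l),
        (∏ r, d.upper x (stdIndex n k ((Equiv.inv (Equiv.Perm (Fin k)) s) r)) (B r)) *
          ∏ r, d.upperConj x (stdIndex m l (t r)) (B' r) =
      ∑ t : Equiv.Perm (Fin l), (∏ r, d.upper x (stdIndex n k (s⁻¹ r)) (B r)) *
          ∏ r, d.upperConj x (stdIndex m l (t⁻¹ r)) (B' r) := fun s =>
    (Equiv.sum_comp (Equiv.inv (Equiv.Perm (Fin l))) _).symm
  simp only [h3, ← h1, ← h2, basis_eq, Finset.sum_mul_sum]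
  simp only [Finset.mul_sum]
  rw [← sum_sum_comm]
  refine Finset.sum_congr rfl fun C _ => Finset.sum_congr rfl fun C' _ =>
    Finset.sum_congr rfl fun s _ => Finset.sum_congr rfl fun t _ => ?_
  ring

theorem basis_cast (d : Dyad M) (n m : ℕ) {k k' l l' : ℕ} (hk : k = k') (hl : l = l')
    (C : Fin k → Fin 2) (C' : Fin l → Fin 2) (x : M) :
    d.basis n k' m l' (C ∘ Fin.cast hk.symm) (C' ∘ Fin.cast hl.symm) x =
      d.basis n k m l C C' x := by
  subst hk hl
  rfl

theorem comp_eq_average_stdIndex (d : Dyad M) {k l : ℕ} (φ : SpinorField M k l) {i j : ℤ} (hi : 0 ≤ i)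
    (hi' : i ≤ k) (hj : 0 ≤ j) (hj' : j ≤ l) (x : M) :
    d.comp φ i j x = ((k.factorial : ℂ) * (l.factorial : ℂ))⁻¹ *
      ∑ s : Equiv.Perm (Fin k), ∑ t : Equiv.Perm (Fin l),
        d.dyadComp φ (stdIndex ((k : ℤ) - i).toNat k ∘ s) (stdIndex ((l : ℤ) - j).toNat l ∘ t) x := by
  -- No free index survives a full contraction, so the appended blocks consist of the contracted
  -- indices alone, up to the cast between `0 + k` and `k`.
  have hk : ∀ (u : Fin 0 → Fin 2) (C : Fin k → Fin 2),
      Fin.append u C = C ∘ Fin.cast (Nat.zero_add k) := fun u C => by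
    rw [Subsingleton.elim u Fin.elim0, Fin.elim0_append]
  have hl : ∀ (u : Fin 0 → Fin 2) (C : Fin l → Fin 2),
      Fin.append u C = C ∘ Fin.cast (Nat.zero_add l) := fun u C => by
    rw [Subsingleton.elim u Fin.elim0, Fin.elim0_append]
  have e : d.comp φ i j x = ∑ B : Fin k → Fin 2, ∑ C : Fin k → Fin 2, ∑ B' : Fin l → Fin 2,
      ∑ C' : Fin l → Fin 2, (∏ r, eps (B r) (C r)) * (∏ r, eps (B' r) (C' r)) *
        (d.basis ((k : ℤ) - i).toNat k ((l : ℤ) - j).toNat l C C' x * φ B B' x) := by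
    rw [comp, if_pos ⟨hi, hi', hj, hj'⟩, symProd, symContract, symmetrize]
    simp only [Nat.add_zero, Nat.factorial_zero, Nat.cast_one, mul_one, inv_one, one_mul,
      Fintype.sum_unique, hk, hl]
    refine Finset.sum_congr rfl fun B _ => Finset.sum_congr rfl fun C _ =>
      Finset.sum_congr rfl fun B' _ => Finset.sum_congr rfl fun C' _ => ?_
    rw [d.basis_cast _ _ (Nat.zero_add k).symm (Nat.zero_add l).symm]
    rfl
  have e2 : d.comp φ i j x = ∑ B : Fin k → Fin 2, ∑ B' : Fin l → Fin 2,
      (∑ C : Fin k → Fin 2, ∑ C' : Fin l → Fin 2,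
        (∏ r, eps (B r) (C r)) * (∏ r, eps (B' r) (C' r)) *
        d.basis ((k : ℤ) - i).toNat k ((l : ℤ) - j).toNat l C C' x) * φ B B' x := by
    rw [e]
    refine Finset.sum_congr rfl fun B _ => ?_
    rw [Finset.sum_comm]
    refine Finset.sum_congr rfl fun B' _ => ?_
    simp only [Finset.sum_mul, mul_assoc]
  rw [e2]
  simp only [sum_eps_basis, dyadComp, frameComp, Finset.mul_sum, Finset.sum_mul]
  rw [sum_sum_comm]
  refine Finset.sum_congr rfl fun C _ => Finset.sum_congr rfl fun C' _ =>
    Finset.sum_congr rfl fun s _ => Finset.sum_congr rfl fun t _ => ?_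
  simp only [Function.comp]
  ring

/-- The component `φ_{ij'}` is the average over all permutations of any dyad component with
`i` unprimed and `j` primed indices equal to `1`. -/
theorem comp_eq_average (d : Dyad M) {k l : ℕ} (φ : SpinorField M k l) (b : Fin k → Fin 2)
    (b' : Fin l → Fin 2) (x : M) :
    d.comp φ (numOnes b) (numOnes b') x = ((k.factorial : ℂ) * (l.factorial : ℂ))⁻¹ *
      ∑ s : Equiv.Perm (Fin k), ∑ t : Equiv.Perm (Fin l),
        d.dyadComp φ (b ∘ s) (b' ∘ t) x := by
  rw [d.comp_eq_average_stdIndex φ (numOnes_nonneg b) (numOnes_le b) (numOnes_nonneg b')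
    (numOnes_le b')]
  obtain ⟨s, hs⟩ := exists_perm_of_numOnes_eq
    (numOnes_stdIndex (numOnes_nonneg b) (numOnes_le b)).symm
  obtain ⟨t, ht⟩ := exists_perm_of_numOnes_eq
    (numOnes_stdIndex (numOnes_nonneg b') (numOnes_le b')).symm
  rw [← hs, ← ht]
  congr 1
  -- As `(b ∘ s) ∘ s' = b ∘ (s * s')`, left translation of the permutation group absorbs the choice
  -- of representative.
  exact Fintype.sum_equiv (Equiv.mulLeft s) _ _ fun s' =>
    Fintype.sum_equiv (Equiv.mulLeft t) _ _ fun t' => rfl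

theorem dyadComp_comp_perm (d : Dyad M) {k l : ℕ} (φ : SpinorField M k l) (b : Fin k → Fin 2)
    (b' : Fin l → Fin 2) (s : Equiv.Perm (Fin k)) (t : Equiv.Perm (Fin l)) (x : M) :
    d.dyadComp φ (b ∘ s) (b' ∘ t) x = d.dyadComp (fun A A' => φ (A ∘ s) (A' ∘ t)) b b' x := by
  simp only [dyadComp, ← frameComp_comp_perm]

theorem dyadComp_comp_perm_of_symm (d : Dyad M) {k l : ℕ} {φ : SpinorField M k l}
    (hφ : ∀ (s : Equiv.Perm (Fin k)) (t : Equiv.Perm (Fin l)) A A', φ (A ∘ s) (A' ∘ t) = φ A A')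
    (b : Fin k → Fin 2) (b' : Fin l → Fin 2) (s : Equiv.Perm (Fin k)) (t : Equiv.Perm (Fin l))
    (x : M) : d.dyadComp φ (b ∘ s) (b' ∘ t) x = d.dyadComp φ b b' x := by
  simp only [dyadComp_comp_perm, hφ]

/-- For symmetric `φ` all terms of the average in `comp_eq_average` coincide. -/
theorem comp_eq_dyadComp (d : Dyad M) {k l : ℕ} {φ : SpinorField M k l}
    (hφ : ∀ (s : Equiv.Perm (Fin k)) (t : Equiv.Perm (Fin l)) A A', φ (A ∘ s) (A' ∘ t) = φ A A')
    (b : Fin k → Fin 2) (b' : Fin l → Fin 2) (x : M) :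
    d.comp φ (numOnes b) (numOnes b') x = d.dyadComp φ b b' x := by
  rw [comp_eq_average]
  simp only [d.dyadComp_comp_perm_of_symm hφ, average_const]

/-- The components of a symmetrization are averages of dyad components. -/
theorem comp_symmetrize (d : Dyad M) {k l : ℕ} (T : SpinorField M k l) (b : Fin k → Fin 2)
    (b' : Fin l → Fin 2) (x : M) :
    d.comp (symmetrize T) (numOnes b) (numOnes b') x =
      ((k.factorial : ℂ) * (l.factorial : ℂ))⁻¹ *
      ∑ s : Equiv.Perm (Fin k), ∑ t : Equiv.Perm (Fin l),
        d.dyadComp T (b ∘ s) (b' ∘ t) x := by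
  rw [d.comp_eq_dyadComp (symmetrize_symm T)]
  simp only [dyadComp_comp_perm]
  simp only [dyadComp, symmetrize, frameComp_mul, frameComp_sum]

end Dyad

end

/-! ### Differentiability and the Leibniz rule in a moving frame -/

section Differentiable

variable {M : Type*} [TopologicalSpace M] [ChartedSpace E4 M] {x : M}

theorem mdifferentiableAt_sum {ι : Type*} (s : Finset ι) {f : ι → M → ℂ}
    (hf : ∀ i ∈ s, MDifferentiableAt 𝓘(ℝ, E4) 𝓘(ℝ, ℂ) (f i) x) :
    MDifferentiableAt 𝓘(ℝ, E4) 𝓘(ℝ, ℂ) (fun y => ∑ i ∈ s, f i y) x := by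
  classical
  induction s using Finset.induction_on with
  | empty => simpa using mdifferentiableAt_const
  | insert i s hi ih =>
    simp only [Finset.sum_insert hi]
    exact (hf i (by simp)).add (ih fun j hj => hf j (by simp [hj]))

theorem mdifferentiableAt_prod {ι : Type*} (s : Finset ι) {f : ι → M → ℂ}
    (hf : ∀ i ∈ s, MDifferentiableAt 𝓘(ℝ, E4) 𝓘(ℝ, ℂ) (f i) x) :
    MDifferentiableAt 𝓘(ℝ, E4) 𝓘(ℝ, ℂ) (fun y => ∏ i ∈ s, f i y) x := by
  classical
  induction s using Finset.induction_on with
  | empty => simpa using mdifferentiableAt_const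
  | insert i s hi ih =>
    simp only [Finset.prod_insert hi]
    exact (hf i (by simp)).mul (ih fun j hj => hf j (by simp [hj]))

theorem mdifferentiableAt_conj {f : M → ℂ} (hf : MDifferentiableAt 𝓘(ℝ, E4) 𝓘(ℝ, ℂ) f x) :
    MDifferentiableAt 𝓘(ℝ, E4) 𝓘(ℝ, ℂ) (fun y => conj (f y)) x :=
  (Complex.conjCLE.toContinuousLinearMap.hasMFDerivAt.comp x hf.hasMFDerivAt).mdifferentiableAt

theorem mdifferentiableAt_frameComp {n : ℕ} {w : M → Fin 2 → Fin 2 → ℂ}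
    (hw : ∀ c C, MDifferentiableAt 𝓘(ℝ, E4) 𝓘(ℝ, ℂ) (fun y => w y c C) x)
    {T : (Fin n → Fin 2) → M → ℂ} (hT : ∀ A, MDifferentiableAt 𝓘(ℝ, E4) 𝓘(ℝ, ℂ) (T A) x)
    (b : Fin n → Fin 2) :
    MDifferentiableAt 𝓘(ℝ, E4) 𝓘(ℝ, ℂ) (fun y => frameComp (w y) b fun A => T A y) x :=
  mdifferentiableAt_sum _ fun A _ => (mdifferentiableAt_prod _ fun r _ => hw (b r) (A r)).mul (hT A)

end Differentiable

section

variable {M : Type*} [TopologicalSpace M] [ChartedSpace E4 M] [IsManifold 𝓘(ℝ, E4) ∞ M]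

namespace SpinSpacetime

section FrameDeriv

variable (X : SpinSpacetime M) (a : Fin 4) {x : M}

theorem frameDeriv_mul {f g : M → ℂ} (hf : MDifferentiableAt 𝓘(ℝ, E4) 𝓘(ℝ, ℂ) f x)
    (hg : MDifferentiableAt 𝓘(ℝ, E4) 𝓘(ℝ, ℂ) g x) :
    X.frameDeriv a (fun y => f y * g y) x = f x * X.frameDeriv a g x + X.frameDeriv a f x * g x := by
  have h := (hf.hasMFDerivAt.mul hg.hasMFDerivAt).mfderiv
  have h2 : X.frameDeriv a (fun y => f y * g y) x =
      f x * X.frameDeriv a g x + g x * X.frameDeriv a f x :=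
    congrArg (fun L => L (X.tetrad a x)) h
  rw [h2, mul_comm (g x)]

theorem frameDeriv_const (c : ℂ) : X.frameDeriv a (fun _ => c) x = 0 := by
  simp only [frameDeriv, mfderiv_const]
  rfl

theorem frameDeriv_add {f g : M → ℂ} (hf : MDifferentiableAt 𝓘(ℝ, E4) 𝓘(ℝ, ℂ) f x)
    (hg : MDifferentiableAt 𝓘(ℝ, E4) 𝓘(ℝ, ℂ) g x) :
    X.frameDeriv a (fun y => f y + g y) x = X.frameDeriv a f x + X.frameDeriv a g x :=
  congrArg (fun L => L (X.tetrad a x)) (hf.hasMFDerivAt.add hg.hasMFDerivAt).mfderiv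

theorem frameDeriv_neg {f : M → ℂ} (hf : MDifferentiableAt 𝓘(ℝ, E4) 𝓘(ℝ, ℂ) f x) :
    X.frameDeriv a (fun y => -f y) x = -X.frameDeriv a f x :=
  congrArg (fun L => L (X.tetrad a x)) hf.hasMFDerivAt.neg.mfderiv

theorem frameDeriv_sum {ι : Type*} (s : Finset ι) {f : ι → M → ℂ}
    (hf : ∀ i ∈ s, MDifferentiableAt 𝓘(ℝ, E4) 𝓘(ℝ, ℂ) (f i) x) :
    X.frameDeriv a (fun y => ∑ i ∈ s, f i y) x = ∑ i ∈ s, X.frameDeriv a (f i) x := by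
  classical
  induction s using Finset.induction_on with
  | empty => simp [frameDeriv_const]
  | insert i s hi ih =>
    have hs : ∀ j ∈ s, MDifferentiableAt 𝓘(ℝ, E4) 𝓘(ℝ, ℂ) (f j) x :=
      fun j hj => hf j (by simp [hj])
    simp only [Finset.sum_insert hi]
    rw [X.frameDeriv_add a (hf i (by simp)) (mdifferentiableAt_sum s hs), ih hs]

theorem frameDeriv_prod {ι : Type*} [DecidableEq ι] (s : Finset ι) {f : ι → M → ℂ}
    (hf : ∀ i ∈ s, MDifferentiableAt 𝓘(ℝ, E4) 𝓘(ℝ, ℂ) (f i) x) :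
    X.frameDeriv a (fun y => ∏ i ∈ s, f i y) x =
      ∑ i ∈ s, (∏ j ∈ s.erase i, f j x) * X.frameDeriv a (f i) x := by
  induction s using Finset.induction_on with
  | empty => simp [frameDeriv_const]
  | insert i s hi ih =>
    have hs : ∀ j ∈ s, MDifferentiableAt 𝓘(ℝ, E4) 𝓘(ℝ, ℂ) (f j) x :=
      fun j hj => hf j (by simp [hj])
    simp only [Finset.prod_insert hi]
    rw [X.frameDeriv_mul a (hf i (by simp)) (mdifferentiableAt_prod s hs), ih hs,
      Finset.sum_insert hi, Finset.erase_insert hi, Finset.mul_sum, add_comm]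
    refine congrArg₂ (· + ·) (mul_comm _ _) (Finset.sum_congr rfl fun j hj => ?_)
    have hij : i ≠ j := fun h => hi (h ▸ hj)
    rw [Finset.erase_insert_of_ne hij, Finset.prod_insert (by simp [hi]), mul_assoc]

theorem frameDeriv_conj {f : M → ℂ} (hf : MDifferentiableAt 𝓘(ℝ, E4) 𝓘(ℝ, ℂ) f x) :
    X.frameDeriv a (fun y => conj (f y)) x = conj (X.frameDeriv a f x) :=
  congrArg (fun L => L (X.tetrad a x))
    (Complex.conjCLE.toContinuousLinearMap.hasMFDerivAt.comp x hf.hasMFDerivAt).mfderiv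

/-- The Leibniz rule for the components of a tensor in a moving frame `w`, with the connection
coefficients `G` and `∇ w_c = m_c^{c'} w_{c'}`. -/
theorem frameComp_covariantDeriv {n : ℕ} {w : M → Fin 2 → Fin 2 → ℂ}
    (hw : ∀ c C, MDifferentiableAt 𝓘(ℝ, E4) 𝓘(ℝ, ℂ) (fun y => w y c C) x)
    {T : (Fin n → Fin 2) → M → ℂ} (hT : ∀ A, MDifferentiableAt 𝓘(ℝ, E4) 𝓘(ℝ, ℂ) (T A) x)
    {G m : Fin 2 → Fin 2 → ℂ}
    (hm : ∀ c C, X.frameDeriv a (fun y => w y c C) x + ∑ B, G C B * w x c B =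
      ∑ c', m c c' * w x c' C) (b : Fin n → Fin 2) :
    frameComp (w x) b (fun A => X.frameDeriv a (T A) x -
        ∑ r, ∑ C, G C (A r) * T (Function.update A r C) x) =
      X.frameDeriv a (fun y => frameComp (w y) b fun A => T A y) x -
        ∑ r, ∑ c, m (b r) c * frameComp (w x) (Function.update b r c) fun A => T A x := by
  have hprod : ∀ A : Fin n → Fin 2, MDifferentiableAt 𝓘(ℝ, E4) 𝓘(ℝ, ℂ)
      (fun y => ∏ r, w y (b r) (A r)) x := fun A => mdifferentiableAt_prod _ fun r _ => hw _ _
  -- The product rule gives the derivative of `T` and one term for each differentiated frame vector.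
  have h1 : X.frameDeriv a (fun y => frameComp (w y) b fun A => T A y) x =
      frameComp (w x) b (fun A => X.frameDeriv a (T A) x) +
      ∑ r, ∑ A : Fin n → Fin 2, (∏ s ∈ Finset.univ.erase r, w x (b s) (A s)) *
        X.frameDeriv a (fun y => w y (b r) (A r)) x * T A x := by
    unfold frameComp
    rw [X.frameDeriv_sum a (f := fun A y => (∏ r, w y (b r) (A r)) * T A y) _
      fun A _ => (hprod A).mul (hT A), Finset.sum_comm,
      ← Finset.sum_add_distrib]
    refine Finset.sum_congr rfl fun A _ => ?_
    rw [X.frameDeriv_mul a (hprod A) (hT A), X.frameDeriv_prod a _ fun r _ => hw _ _,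
      Finset.sum_mul]
  -- By `hm`, replacing `w (b r)` by its covariant derivative yields its plain derivative plus a
  -- connection term, and the latter is the action of `G` on slot `r` of `T`.
  have h2 : ∀ r, ∑ c, m (b r) c * (frameComp (w x) (Function.update b r c) fun A => T A x) =
      ∑ A : Fin n → Fin 2, (∏ s ∈ Finset.univ.erase r, w x (b s) (A s)) *
        X.frameDeriv a (fun y => w y (b r) (A r)) x * T A x +
      frameComp (w x) b fun A => ∑ C, G C (A r) * T (Function.update A r C) x := by
    intro r
    simp only [frameComp]
    rw [sum_prod_mul_update (w x) G b (fun A => T A x) r, ← Finset.sum_add_distrib]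
    simp only [prod_update_left, Finset.mul_sum]
    rw [Finset.sum_comm]
    refine Finset.sum_congr rfl fun A _ => ?_
    simp only [← Finset.mul_sum]
    rw [← add_mul, ← mul_add, hm, Finset.mul_sum, Finset.sum_mul]
    exact Finset.sum_congr rfl fun c _ => by ring
  rw [frameComp_sub, frameComp_sum, h1, Finset.sum_congr rfl fun r _ => h2 r,
    Finset.sum_add_distrib]
  ring

end FrameDeriv

end SpinSpacetime

end

/-! ### The spin connection in the dyad and the components of `∇φ` -/

theorem conj_ivdwInv (a : Fin 4) (A A' : Fin 2) : conj (ivdwInv a A A') = ivdwInv a A' A := by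
  fin_cases a <;> fin_cases A <;> fin_cases A' <;> simp [ivdwInv, ivdw]

section

variable {M : Type*} [TopologicalSpace M] [ChartedSpace E4 M]

namespace Dyad

theorem mdifferentiableAt_lower (d : Dyad M) (x : M) (c C : Fin 2) :
    MDifferentiableAt 𝓘(ℝ, E4) 𝓘(ℝ, ℂ) (fun y => d.lower y c C) x := by
  fin_cases c
  · exact (d.o_smooth C x).mdifferentiableAt (by simp)
  · exact (d.iota_smooth C x).mdifferentiableAt (by simp)

theorem upper_zero (d : Dyad M) (x : M) (c : Fin 2) : d.upper x c 0 = d.lower x c 1 := by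
  simp [← sum_eps_lower, eps]

theorem upper_one (d : Dyad M) (x : M) (c : Fin 2) : d.upper x c 1 = -d.lower x c 0 := by
  simp [← sum_eps_lower, eps]

theorem mdifferentiableAt_upper (d : Dyad M) (x : M) (c C : Fin 2) :
    MDifferentiableAt 𝓘(ℝ, E4) 𝓘(ℝ, ℂ) (fun y => d.upper y c C) x := by
  fin_cases C
  · exact (d.mdifferentiableAt_lower x c 1).congr_of_eventuallyEq
      (.of_forall fun y => d.upper_zero y c)
  · exact (d.mdifferentiableAt_lower x c 0).neg.congr_of_eventuallyEq
      (.of_forall fun y => d.upper_one y c)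

end Dyad

end

section

variable {M : Type*} [TopologicalSpace M] [ChartedSpace E4 M] [IsManifold 𝓘(ℝ, E4) ∞ M]

namespace SpinSpacetime

variable (X : SpinSpacetime M) (d : Dyad M)

/-- The covariant derivative along `e_a` of the dyad spinor `o_B` or `ι_B`. -/
def dyadDeriv (a : Fin 4) (x : M) (c B : Fin 2) : ℂ :=
  X.frameDeriv a (fun y => d.lower y c B) x - ∑ C, X.spinCoeff a C B x * d.lower x c C

/-- The connection coefficients along `e_a` in the dyad. -/
def dyadConn (a : Fin 4) (x : M) (c c' : Fin 2) : ℂ :=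
  if c' = 0 then ∑ B, d.iotaUp x B * X.dyadDeriv d a x c B
  else -∑ B, d.oUp x B * X.dyadDeriv d a x c B

theorem dyadDeriv_eq (a : Fin 4) (x : M) (c B : Fin 2) :
    X.dyadDeriv d a x c B = ∑ c', X.dyadConn d a x c c' * d.lower x c' B := by
  rw [d.expansion_one x (X.dyadDeriv d a x c) B]
  simp [dyadConn, Dyad.lower]
  ring

/-- The raised dyad obeys the same equation as the lowered one because raising commutes with `∇`. In
coordinates the discrepancy is a multiple of the trace of the spin connection, which vanishes by
`spinCoeff_trace`. -/
theorem upper_deriv (a : Fin 4) (x : M) (c C : Fin 2) :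
    X.frameDeriv a (fun y => d.upper y c C) x + ∑ B, X.spinCoeff a C B x * d.upper x c B =
      ∑ c', X.dyadConn d a x c c' * d.upper x c' C := by
  have ht := X.spinCoeff_trace a x
  have h0 := X.dyadDeriv_eq d a x c 0
  have h1 := X.dyadDeriv_eq d a x c 1
  simp only [dyadDeriv, Fin.sum_univ_two] at h0 h1 ht
  have e1 := X.frameDeriv_neg a (d.mdifferentiableAt_lower x c 0)
  fin_cases C
  · simp only [Fin.zero_eta, Fin.isValue, Fin.sum_univ_two, d.upper_zero, d.upper_one]
    linear_combination h1 + d.lower x c 1 * ht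
  · simp only [Fin.mk_one, Fin.isValue, Fin.sum_univ_two, d.upper_zero, d.upper_one]
    linear_combination e1 - h0 - d.lower x c 0 * ht

theorem upperConj_deriv (a : Fin 4) (x : M) (c C : Fin 2) :
    X.frameDeriv a (fun y => d.upperConj y c C) x +
        ∑ B, conj (X.spinCoeff a C B x) * d.upperConj x c B =
      ∑ c', conj (X.dyadConn d a x c c') * d.upperConj x c' C := by
  unfold Dyad.upperConj
  rw [X.frameDeriv_conj a (d.mdifferentiableAt_upper x c C)]
  simpa only [map_add, map_sum, map_mul] using congrArg conj (X.upper_deriv d a x c C)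

theorem sum_dyadDeriv_zero (A A' B : Fin 2) (x : M) :
    ∑ a, ivdwInv a A A' * X.dyadDeriv d a x 0 B = X.nabla d.oField A A' ![B] ![] x := by
  simp [dyadDeriv, nabla, Dyad.oField, Dyad.lower]

theorem sum_dyadDeriv_one (A A' B : Fin 2) (x : M) :
    ∑ a, ivdwInv a A A' * X.dyadDeriv d a x 1 B = X.nabla d.iotaField A A' ![B] ![] x := by
  simp [dyadDeriv, nabla, Dyad.iotaField, Dyad.lower]

/-- With the three lemmas after the next one in view, the connection matrix in the dyad is `(ω, Γ;
Γ', -ω)`; its vanishing trace is `omega_symm`. -/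
theorem sum_dyadConn_zero_zero (A A' : Fin 2) (x : M) :
    ∑ a, ivdwInv a A A' * X.dyadConn d a x 0 0 = X.omega d A A' x := by
  simp only [omega, ← sum_dyadDeriv_zero, dyadConn, if_true, Finset.mul_sum]
  rw [Finset.sum_comm]
  exact Finset.sum_congr rfl fun _ _ => Finset.sum_congr rfl fun _ _ => by ring

theorem sum_dyadConn_one_one (A A' : Fin 2) (x : M) :
    ∑ a, ivdwInv a A A' * X.dyadConn d a x 1 1 = -X.omega d A A' x := by
  simp only [← omega_symm, ← sum_dyadDeriv_one, dyadConn, one_ne_zero, if_false, Finset.mul_sum,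
    ← Finset.sum_neg_distrib]
  rw [Finset.sum_comm]
  exact Finset.sum_congr rfl fun _ _ => Finset.sum_congr rfl fun _ _ => by ring

theorem sum_dyadConn_zero_one (A A' : Fin 2) (x : M) :
    ∑ a, ivdwInv a A A' * X.dyadConn d a x 0 1 = X.Gam d A A' x := by
  -- Since `o^B o_B = 0`, the weight correction in `Θ` does not affect `Γ`.
  have h : ∑ B, d.oUp x B * d.o B x = 0 := by
    simp [Dyad.oUp, raise, eps]
    ring
  have e : X.Gam d A A' x = -∑ B, d.oUp x B * X.nabla d.oField A A' ![B] ![] x := by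
    simp only [Fin.sum_univ_two] at h
    simp only [Gam, theta, Fin.sum_univ_two, Dyad.oField, Matrix.cons_val_zero]
    push_cast
    linear_combination X.omega d A A' x * h
  rw [e]
  simp only [← sum_dyadDeriv_zero, dyadConn, one_ne_zero, if_false, Finset.mul_sum,
    ← Finset.sum_neg_distrib]
  rw [Finset.sum_comm]
  exact Finset.sum_congr rfl fun _ _ => Finset.sum_congr rfl fun _ _ => by ring

theorem sum_dyadConn_one_zero (A A' : Fin 2) (x : M) :
    ∑ a, ivdwInv a A A' * X.dyadConn d a x 1 0 = X.Gam' d A A' x := by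
  have h : ∑ B, d.iotaUp x B * d.iota B x = 0 := by
    simp [Dyad.iotaUp, raise, eps]
    ring
  have e : X.Gam' d A A' x = ∑ B, d.iotaUp x B * X.nabla d.iotaField A A' ![B] ![] x := by
    simp only [Fin.sum_univ_two] at h
    simp only [Gam', theta, Fin.sum_univ_two, Dyad.iotaField, Matrix.cons_val_zero]
    push_cast
    linear_combination X.omega d A A' x * h
  rw [e]
  simp only [← sum_dyadDeriv_one, dyadConn, if_true, Finset.mul_sum]
  rw [Finset.sum_comm]
  exact Finset.sum_congr rfl fun _ _ => Finset.sum_congr rfl fun _ _ => by ring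

/-- The Infeld–van der Waerden symbols are Hermitian, so conjugation exchanges `A` and `A'`. -/
theorem sum_conj_dyadConn (A A' : Fin 2) (x : M) (c c' : Fin 2) :
    ∑ a, ivdwInv a A A' * conj (X.dyadConn d a x c c') =
      conj (∑ a, ivdwInv a A' A * X.dyadConn d a x c c') := by
  simp only [map_sum, map_mul, conj_ivdwInv]

theorem dyadComp_nabla (A A' : Fin 2) {k l : ℕ} {φ : SpinorField M k l} {x : M}
    (hφ : ∀ B B', MDifferentiableAt 𝓘(ℝ, E4) 𝓘(ℝ, ℂ) (φ B B') x)
    (b : Fin k → Fin 2) (b' : Fin l → Fin 2) :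
    d.dyadComp (X.nabla φ A A') b b' x = ∑ a, ivdwInv a A A' *
      (X.frameDeriv a (d.dyadComp φ b b') x
        - (∑ r, ∑ c, X.dyadConn d a x (b r) c * d.dyadComp φ (Function.update b r c) b' x)
        - ∑ r, ∑ c, conj (X.dyadConn d a x (b' r) c) *
            d.dyadComp φ b (Function.update b' r c) x) := by
  have hu := d.mdifferentiableAt_upper x
  have hu' : ∀ c C, MDifferentiableAt 𝓘(ℝ, E4) 𝓘(ℝ, ℂ) (fun y => d.upperConj y c C) x :=
    fun c C => mdifferentiableAt_conj (hu c C)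
  simp only [Dyad.dyadComp, nabla, frameComp_sum, frameComp_mul]
  refine Finset.sum_congr rfl fun a _ => congrArg _ ?_
  -- The Leibniz rule is applied to the primed slots with the unprimed indices fixed; then, in `h2`,
  -- to the unprimed slots of the resulting field of primed components.
  have h1 : ∀ B : Fin k → Fin 2,
      (frameComp (d.upperConj x) b' fun B' => X.frameDeriv a (φ B B') x
        - (∑ r, ∑ C, X.spinCoeff a C (B r) x * φ (Function.update B r C) B' x)
        - ∑ r, ∑ C, conj (X.spinCoeff a C (B' r) x) * φ B (Function.update B' r C) x) =
      (X.frameDeriv a (fun y => frameComp (d.upperConj y) b' fun B' => φ B B' y) x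
        - ∑ r, ∑ C, X.spinCoeff a C (B r) x *
            frameComp (d.upperConj x) b' fun B' => φ (Function.update B r C) B' x)
        - ∑ r, ∑ c, conj (X.dyadConn d a x (b' r) c) *
            frameComp (d.upperConj x) (Function.update b' r c) fun B' => φ B B' x := by
    intro B
    have h := X.frameComp_covariantDeriv a hu' (hφ B)
      (G := fun C B => conj (X.spinCoeff a C B x)) (m := fun c c' => conj (X.dyadConn d a x c c'))
      (X.upperConj_deriv d a x) b'
    simp only [frameComp_sub, frameComp_sum, frameComp_mul] at h ⊢
    linear_combination h
  have h2 := X.frameComp_covariantDeriv a hu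
    (T := fun B y => frameComp (d.upperConj y) b' fun B' => φ B B' y)
    (fun B => mdifferentiableAt_frameComp hu' (hφ B) b')
    (G := fun C B => X.spinCoeff a C B x) (m := X.dyadConn d a x) (X.upper_deriv d a x) b
  simp only [h1]
  rw [frameComp_sub, h2]
  simp only [frameComp_sum, frameComp_mul]
  rfl

/-- The dyad components of `∇_{AA'} φ` in terms of the GHP connection. -/
theorem dyadComp_nabla_eq_thetaScalar (A A' : Fin 2) {k l : ℕ} {φ : SpinorField M k l}
    (hφ : φ ∈ symSpinors M k l) (x : M) (b : Fin k → Fin 2) (b' : Fin l → Fin 2) {i j : ℤ}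
    (hi : numOnes b = i) (hj : numOnes b' = j) :
    d.dyadComp (X.nabla φ A A') b b' x =
      X.thetaScalar d (k - 2 * i) (l - 2 * j) (d.comp φ i j) A A' x
      - (k - i) * X.Gam d A A' x * d.comp φ (i + 1) j x
      - i * X.Gam' d A A' x * d.comp φ (i - 1) j x
      - (l - j) * conj (X.Gam d A' A x) * d.comp φ i (j + 1) x
      - j * conj (X.Gam' d A' A x) * d.comp φ i (j - 1) x := by
  subst hi hj
  have hs := hφ.2
  rw [X.dyadComp_nabla d A A' fun B B' => (hφ.1 B B' x).mdifferentiableAt (by simp)]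
  -- The equality is needed on all of `M`, since these scalars get differentiated.
  have hfun : d.dyadComp φ b b' = d.comp φ (numOnes b) (numOnes b') :=
    funext fun y => (d.comp_eq_dyadComp hs b b' y).symm
  have h1 : ∀ a, ∑ r, ∑ c, X.dyadConn d a x (b r) c * d.dyadComp φ (Function.update b r c) b' x =
      ((k : ℂ) - numOnes b) * (X.dyadConn d a x 0 0 * d.comp φ (numOnes b) (numOnes b') x
        + X.dyadConn d a x 0 1 * d.comp φ (numOnes b + 1) (numOnes b') x)
      + numOnes b * (X.dyadConn d a x 1 0 * d.comp φ (numOnes b - 1) (numOnes b') x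
        + X.dyadConn d a x 1 1 * d.comp φ (numOnes b) (numOnes b') x) := by
    intro a
    simp only [← d.comp_eq_dyadComp hs, numOnes_update]
    -- The factors `k - i` and `i` count the indices along `o` and `ι`. A component with index out
    -- of range appears only with factor zero.
    rw [sum_comp_eq b fun e => ∑ c : Fin 2, X.dyadConn d a x e c *
      d.comp φ (numOnes b - ((e : ℕ) : ℤ) + ((c : ℕ) : ℤ)) (numOnes b') x]
    simp [Fin.sum_univ_two]
  have h2 : ∀ a, ∑ r, ∑ c, conj (X.dyadConn d a x (b' r) c) *
        d.dyadComp φ b (Function.update b' r c) x =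
      ((l : ℂ) - numOnes b') * (conj (X.dyadConn d a x 0 0) * d.comp φ (numOnes b) (numOnes b') x
        + conj (X.dyadConn d a x 0 1) * d.comp φ (numOnes b) (numOnes b' + 1) x)
      + numOnes b' * (conj (X.dyadConn d a x 1 0) * d.comp φ (numOnes b) (numOnes b' - 1) x
        + conj (X.dyadConn d a x 1 1) * d.comp φ (numOnes b) (numOnes b') x) := by
    intro a
    simp only [← d.comp_eq_dyadComp hs, numOnes_update]
    rw [sum_comp_eq b' fun e => ∑ c : Fin 2, conj (X.dyadConn d a x e c) *
      d.comp φ (numOnes b) (numOnes b' - ((e : ℕ) : ℤ) + ((c : ℕ) : ℤ)) x]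
    simp [Fin.sum_univ_two]
  have g00 := X.sum_dyadConn_zero_zero d A A' x
  have g01 := X.sum_dyadConn_zero_one d A A' x
  have g10 := X.sum_dyadConn_one_zero d A A' x
  have g11 := X.sum_dyadConn_one_one d A A' x
  have c00 := X.sum_conj_dyadConn d A A' x 0 0
  have c01 := X.sum_conj_dyadConn d A A' x 0 1
  have c10 := X.sum_conj_dyadConn d A A' x 1 0
  have c11 := X.sum_conj_dyadConn d A A' x 1 1
  rw [sum_dyadConn_zero_zero] at c00
  rw [sum_dyadConn_zero_one] at c01
  rw [sum_dyadConn_one_zero] at c10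
  rw [sum_dyadConn_one_one, map_neg] at c11
  have ht : X.thetaScalar d (k - 2 * numOnes b) (l - 2 * numOnes b')
      (d.comp φ (numOnes b) (numOnes b')) A A' x =
      ∑ a, ivdwInv a A A' * X.frameDeriv a (d.comp φ (numOnes b) (numOnes b')) x
      - (((k : ℂ) - 2 * numOnes b) * X.omega d A A' x
        + ((l : ℂ) - 2 * numOnes b') * conj (X.omega d A' A x)) *
          d.comp φ (numOnes b) (numOnes b') x := by
    simp [thetaScalar, theta, nabla]
  rw [ht, hfun, ← g00, ← g01, ← g10, ← c00, ← c01, ← c10]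
  simp only [h1, h2]
  simp only [Fin.sum_univ_four] at *
  -- The diagonal terms `(k - i) ω - i ω` and their conjugates match the weights in `Θ`.
  linear_combination (-(numOnes b : ℂ) * d.comp φ (numOnes b) (numOnes b') x) * (g00 + g11) -
    (numOnes b' * d.comp φ (numOnes b) (numOnes b') x) * (c00 + c11)

end SpinSpacetime

end

/-! ### Averages over one slot, and dyad components of contractions and products -/

theorem sum_fin_one_arrow (f : (Fin 1 → Fin 2) → ℂ) : ∑ B, f B = ∑ b, f fun _ => b :=
  Fintype.sum_equiv (Equiv.funUnique (Fin 1) (Fin 2)) _ _ fun B =>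
    congrArg f (funext fun r => congrArg B (Subsingleton.elim r _))

theorem average_perm_left {k l : ℕ} (r₀ : Fin (k + 1)) (a : Fin (k + 1) → Fin 2) (F : Fin 2 → ℂ) :
    (((k + 1).factorial : ℂ) * (l.factorial : ℂ))⁻¹ *
      ∑ s : Equiv.Perm (Fin (k + 1)), ∑ _t : Equiv.Perm (Fin l), F (a (s r₀)) =
      (((k : ℂ) + 1 - numOnes a) * F 0 + numOnes a * F 1) / (k + 1) := by
  have h2 : (l.factorial : ℂ) ≠ 0 := Nat.cast_ne_zero.2 l.factorial_ne_zero
  rw [← average_perm r₀ a F, mul_inv, mul_assoc]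
  congr 1
  simp only [Finset.sum_const, Finset.card_univ, Fintype.card_perm, Fintype.card_fin, nsmul_eq_mul,
    ← Finset.mul_sum]
  field_simp

theorem average_perm_right {k l : ℕ} (r₀ : Fin (l + 1)) (a : Fin (l + 1) → Fin 2) (F : Fin 2 → ℂ) :
    ((k.factorial : ℂ) * ((l + 1).factorial : ℂ))⁻¹ *
      ∑ _s : Equiv.Perm (Fin k), ∑ t : Equiv.Perm (Fin (l + 1)), F (a (t r₀)) =
      (((l : ℂ) + 1 - numOnes a) * F 0 + numOnes a * F 1) / (l + 1) := by
  rw [Finset.sum_comm, mul_comm (k.factorial : ℂ), average_perm_left]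

/-- The unprimed and primed permutations are independent, so the one-slot averages are iterated. -/
theorem average_perm_both {k l : ℕ} (r₀ : Fin (k + 1)) (t₀ : Fin (l + 1)) (a : Fin (k + 1) → Fin 2)
    (a' : Fin (l + 1) → Fin 2) (F : Fin 2 → Fin 2 → ℂ) :
    (((k + 1).factorial : ℂ) * ((l + 1).factorial : ℂ))⁻¹ *
      ∑ s : Equiv.Perm (Fin (k + 1)), ∑ t : Equiv.Perm (Fin (l + 1)), F (a (s r₀)) (a' (t t₀)) =
      (((k : ℂ) + 1 - numOnes a) *
          (((l : ℂ) + 1 - numOnes a') * F 0 0 + numOnes a' * F 0 1) +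
        numOnes a * (((l : ℂ) + 1 - numOnes a') * F 1 0 + numOnes a' * F 1 1)) /
        ((k + 1) * (l + 1)) := by
  have h1 : (k : ℂ) + 1 ≠ 0 := Nat.cast_add_one_ne_zero k
  have h2 : (l : ℂ) + 1 ≠ 0 := Nat.cast_add_one_ne_zero l
  rw [mul_inv, mul_assoc, Finset.mul_sum]
  simp only [average_perm t₀ a']
  rw [average_perm r₀ a fun e =>
    (((l : ℂ) + 1 - numOnes a') * F e 0 + numOnes a' * F e 1) / (l + 1)]
  field_simp

section

variable {M : Type*} [TopologicalSpace M] [ChartedSpace E4 M]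

namespace Dyad

/-- The components along the dyad of a spinor field with two additional indices `C, C'`. -/
def blockComp (d : Dyad M) {k l : ℕ} (T : Fin 2 → Fin 2 → SpinorField M k l) (c c' : Fin 2)
    (b : Fin k → Fin 2) (b' : Fin l → Fin 2) (x : M) : ℂ :=
  ∑ C, ∑ C', d.upper x c C * d.upperConj x c' C' * d.dyadComp (T C C') b b' x

variable (d : Dyad M) {k l : ℕ} (x : M)

/-- In each contracted pair the two slots carry opposite dyad labels, with the sign of `ε`. The
primed pair is treated inside the unprimed one. -/
theorem dyadComp_contract_contract (T : Fin 2 → Fin 2 → SpinorField M (k + 1) (l + 1))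
    (a : Fin k → Fin 2) (a' : Fin l → Fin 2) :
    d.dyadComp (fun A A' x => ∑ B, ∑ C, eps B C * ∑ B', ∑ C', eps B' C' *
        T C C' (Fin.snoc A B) (Fin.snoc A' B') x) a a' x =
      d.blockComp T 1 1 (Fin.snoc a 0) (Fin.snoc a' 0) x
      - d.blockComp T 1 0 (Fin.snoc a 0) (Fin.snoc a' 1) x
      - d.blockComp T 0 1 (Fin.snoc a 1) (Fin.snoc a' 0) x
      + d.blockComp T 0 0 (Fin.snoc a 1) (Fin.snoc a' 1) x := by
  let Q : Fin 2 → (Fin (k + 1) → Fin 2) → ℂ := fun C A => ∑ b, ∑ c, eps b c *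
    ∑ C', d.upperConj x c C' * frameComp (d.upperConj x) (Fin.snoc a' b) fun A' => T C C' A A' x
  have h : ∀ A : Fin k → Fin 2,
      (frameComp (d.upperConj x) a' fun A' => ∑ B, ∑ C, eps B C * ∑ B', ∑ C', eps B' C' *
        T C C' (Fin.snoc A B) (Fin.snoc A' B') x) = ∑ B, ∑ C, eps B C * Q C (Fin.snoc A B) := by
    intro A
    rw [frameComp_sum]
    refine Finset.sum_congr rfl fun B _ => ?_
    rw [frameComp_sum]
    refine Finset.sum_congr rfl fun C _ => ?_
    rw [frameComp_mul]
    exact congrArg _ (frameComp_contract _ (d.eps_upperConj x) a'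
      fun C' A' => T C C' (Fin.snoc A B) A' x)
  unfold dyadComp
  simp only [h]
  rw [frameComp_contract _ (d.eps_upper x)]
  simp only [Q, frameComp_sum, frameComp_mul, blockComp, dyadComp]
  simp [Fin.sum_univ_two, eps]
  ring

theorem dyadComp_prepend_contract (T : Fin 2 → Fin 2 → SpinorField M k (l + 1))
    (a : Fin (k + 1) → Fin 2) (a' : Fin l → Fin 2) :
    d.dyadComp (fun A A' x => ∑ B', ∑ C', eps B' C' *
        T (A (Fin.last k)) C' (fun r => A r.castSucc) (Fin.snoc A' B') x) a a' x =
      d.blockComp T (a (Fin.last k)) 1 (fun r => a r.castSucc) (Fin.snoc a' 0) x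
      - d.blockComp T (a (Fin.last k)) 0 (fun r => a r.castSucc) (Fin.snoc a' 1) x := by
  have h : ∀ A : Fin (k + 1) → Fin 2,
      (frameComp (d.upperConj x) a' fun A' => ∑ B', ∑ C', eps B' C' *
        T (A (Fin.last k)) C' (fun r => A r.castSucc) (Fin.snoc A' B') x) = _ := fun A =>
    frameComp_contract _ (d.eps_upperConj x) a'
      fun C' A' => T (A (Fin.last k)) C' (fun r => A r.castSucc) A' x
  unfold dyadComp
  simp only [h]
  rw [frameComp_prepend (d.upper x) a fun C A => ∑ b, ∑ c, eps b c * ∑ C',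
    d.upperConj x c C' * frameComp (d.upperConj x) (Fin.snoc a' b) fun A' => T C C' A A' x]
  simp only [frameComp_sum, frameComp_mul, blockComp, dyadComp]
  simp [Fin.sum_univ_two, eps]
  ring

theorem dyadComp_contract_prepend (T : Fin 2 → Fin 2 → SpinorField M (k + 1) l)
    (a : Fin k → Fin 2) (a' : Fin (l + 1) → Fin 2) :
    d.dyadComp (fun A A' x => ∑ B, ∑ C, eps B C *
        T C (A' (Fin.last l)) (Fin.snoc A B) (fun r => A' r.castSucc) x) a a' x =
      d.blockComp T 1 (a' (Fin.last l)) (Fin.snoc a 0) (fun r => a' r.castSucc) x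
      - d.blockComp T 0 (a' (Fin.last l)) (Fin.snoc a 1) (fun r => a' r.castSucc) x := by
  let Q : Fin 2 → (Fin (k + 1) → Fin 2) → ℂ := fun C A => ∑ C', d.upperConj x (a' (Fin.last l)) C' *
    frameComp (d.upperConj x) (fun r => a' r.castSucc) fun A' => T C C' A A' x
  have h : ∀ A : Fin k → Fin 2,
      (frameComp (d.upperConj x) a' fun A' => ∑ B, ∑ C, eps B C *
        T C (A' (Fin.last l)) (Fin.snoc A B) (fun r => A' r.castSucc) x) =
        ∑ B, ∑ C, eps B C * Q C (Fin.snoc A B) := by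
    intro A
    rw [frameComp_sum]
    refine Finset.sum_congr rfl fun B _ => ?_
    rw [frameComp_sum]
    refine Finset.sum_congr rfl fun C _ => ?_
    rw [frameComp_mul]
    exact congrArg _ (frameComp_prepend _ a' fun C' A' => T C C' (Fin.snoc A B) A' x)
  unfold dyadComp
  simp only [h]
  rw [frameComp_contract _ (d.eps_upper x)]
  simp only [Q, frameComp_sum, frameComp_mul, blockComp, dyadComp]
  simp [Fin.sum_univ_two, eps]
  ring

theorem dyadComp_prepend_prepend (T : Fin 2 → Fin 2 → SpinorField M k l)
    (a : Fin (k + 1) → Fin 2) (a' : Fin (l + 1) → Fin 2) :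
    d.dyadComp (fun A A' x => T (A (Fin.last k)) (A' (Fin.last l)) (fun r => A r.castSucc)
        (fun r => A' r.castSucc) x) a a' x =
      d.blockComp T (a (Fin.last k)) (a' (Fin.last l)) (fun r => a r.castSucc)
        (fun r => a' r.castSucc) x := by
  have h : ∀ A : Fin (k + 1) → Fin 2,
      (frameComp (d.upperConj x) a' fun A' => T (A (Fin.last k)) (A' (Fin.last l))
        (fun r => A r.castSucc) (fun r => A' r.castSucc) x) = _ := fun A =>
    frameComp_prepend _ a' fun C' A' => T (A (Fin.last k)) C' (fun r => A r.castSucc) A' x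
  unfold dyadComp
  simp only [h]
  rw [frameComp_prepend (d.upper x) a fun C A => ∑ C', d.upperConj x (a' (Fin.last l)) C' *
    frameComp (d.upperConj x) (fun r => a' r.castSucc) fun A' => T C C' A A' x]
  simp only [frameComp_sum, frameComp_mul, blockComp, dyadComp]
  simp only [Finset.mul_sum, mul_assoc]

end Dyad

end

/-! ### The fundamental operators in terms of the components of `∇φ` -/

section

variable {M : Type*} [TopologicalSpace M] [ChartedSpace E4 M] [IsManifold 𝓘(ℝ, E4) ∞ M]

namespace SpinSpacetime

variable (X : SpinSpacetime M) (d : Dyad M) {k l : ℕ}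

theorem fundD_eq (φ : SpinorField M (k + 1) (l + 1)) :
    X.fundD φ = symmetrize fun A A' x => ∑ B, ∑ C, eps B C * ∑ B', ∑ C', eps B' C' *
      X.nabla φ C C' (Fin.snoc A B) (Fin.snoc A' B') x := by
  change symContract (k := 0) (l := 0) 1 1 (X.nablaBlock φ) = _
  unfold symContract
  congr 1
  funext A A' x
  simp only [sum_fin_one_arrow, Fin.append_right_eq_snoc, nablaBlock, Finset.prod_const,
    Finset.card_univ, Fintype.card_fin, pow_one, Finset.mul_sum, mul_assoc]
  rfl

/-- `symContract` lists the free indices of its first block after those of the second, which is why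
the free index of `∇` sits in the last slot. -/
theorem fundC_eq (φ : SpinorField M k (l + 1)) :
    X.fundC φ = symmetrize fun A A' x => ∑ B', ∑ C', eps B' C' *
      X.nabla φ (A (Fin.last k)) C' (fun r => A r.castSucc) (Fin.snoc A' B') x := by
  change symContract (k := 1) (l := 0) 0 1 (X.nablaBlock φ) = _
  unfold symContract
  congr 1
  funext A A' x
  simp only [sum_fin_one_arrow, Fin.append_right_eq_snoc, Fin.append_right_nil, nablaBlock,
    Finset.univ_eq_empty, Finset.prod_empty, Finset.univ_unique, Finset.prod_singleton, one_mul,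
    Finset.sum_singleton]
  rfl

theorem fundCdag_eq (φ : SpinorField M (k + 1) l) :
    X.fundCdag φ = symmetrize fun A A' x => ∑ B, ∑ C, eps B C *
      X.nabla φ C (A' (Fin.last l)) (Fin.snoc A B) (fun r => A' r.castSucc) x := by
  change symContract (k := 0) (l := 1) 1 0 (X.nablaBlock φ) = _
  unfold symContract
  congr 1
  funext A A' x
  simp only [sum_fin_one_arrow, Fin.append_right_eq_snoc, Fin.append_right_nil, nablaBlock,
    Finset.univ_eq_empty, Finset.prod_empty, Finset.univ_unique, Finset.prod_singleton, mul_one,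
    Finset.sum_singleton]
  rfl

theorem fundT_eq (φ : SpinorField M k l) :
    X.fundT φ = symmetrize fun A A' x => X.nabla φ (A (Fin.last k)) (A' (Fin.last l))
      (fun r => A r.castSucc) (fun r => A' r.castSucc) x := by
  unfold fundT symContract
  congr 1
  funext A A' x
  simp only [Fin.append_right_nil, nablaBlock,
    Finset.univ_eq_empty, Finset.prod_empty, one_mul,
    Fintype.sum_unique]
  rfl

/-- The dyad components of `∇φ` in terms of the GHP connection. -/
def nablaComp (φ : SpinorField M k l) (c c' : Fin 2) (i j : ℤ) (x : M) : ℂ :=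
  ∑ A, ∑ A', d.upper x c A * d.upperConj x c' A' *
    (X.thetaScalar d (k - 2 * i) (l - 2 * j) (d.comp φ i j) A A' x
      - (k - i) * X.Gam d A A' x * d.comp φ (i + 1) j x
      - i * X.Gam' d A A' x * d.comp φ (i - 1) j x
      - (l - j) * conj (X.Gam d A' A x) * d.comp φ i (j + 1) x
      - j * conj (X.Gam' d A' A x) * d.comp φ i (j - 1) x)

theorem blockComp_nabla {φ : SpinorField M k l} (hφ : φ ∈ symSpinors M k l) (c c' : Fin 2)
    {b : Fin k → Fin 2} {b' : Fin l → Fin 2} (x : M) :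
    d.blockComp (X.nabla φ) c c' b b' x = X.nablaComp d φ c c' (numOnes b) (numOnes b') x :=
  Finset.sum_congr rfl fun A _ => Finset.sum_congr rfl fun A' _ => by
    rw [X.dyadComp_nabla_eq_thetaScalar d A A' hφ x b b' rfl rfl]

variable (φ : SpinorField M k l) (i j : ℤ) (x : M)

theorem nablaComp_zero_zero : X.nablaComp d φ 0 0 i j x =
    X.tho d (k - 2 * i) (l - 2 * j) (d.comp φ i j) x
      + (k - i) * X.kappa d x * d.comp φ (i + 1) j x
      + i * X.tau' d x * d.comp φ (i - 1) j x
      + (l - j) * conj (X.kappa d x) * d.comp φ i (j + 1) x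
      + j * conj (X.tau' d x) * d.comp φ i (j - 1) x := by
  simp [nablaComp, tho, kappa, tau', Dyad.upperConj, Dyad.upper]
  ring

/-- Conjugation exchanges the two derivative slots, so in the mixed components `σ` is accompanied by
`ρ̄`, and `ρ'` by `σ̄'`. The minus signs in the definitions of the spin coefficients make all
corrections positive. -/
theorem nablaComp_zero_one : X.nablaComp d φ 0 1 i j x =
    X.edt d (k - 2 * i) (l - 2 * j) (d.comp φ i j) x
      + (k - i) * X.sigma d x * d.comp φ (i + 1) j x
      + i * X.rho' d x * d.comp φ (i - 1) j x
      + (l - j) * conj (X.rho d x) * d.comp φ i (j + 1) x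
      + j * conj (X.sigma' d x) * d.comp φ i (j - 1) x := by
  simp [nablaComp, edt, sigma, rho', rho, sigma', Dyad.upperConj, Dyad.upper]
  ring

theorem nablaComp_one_zero : X.nablaComp d φ 1 0 i j x =
    X.edt' d (k - 2 * i) (l - 2 * j) (d.comp φ i j) x
      + (k - i) * X.rho d x * d.comp φ (i + 1) j x
      + i * X.sigma' d x * d.comp φ (i - 1) j x
      + (l - j) * conj (X.sigma d x) * d.comp φ i (j + 1) x
      + j * conj (X.rho' d x) * d.comp φ i (j - 1) x := by
  simp [nablaComp, edt', sigma, rho', rho, sigma', Dyad.upperConj, Dyad.upper]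
  ring

theorem nablaComp_one_one : X.nablaComp d φ 1 1 i j x =
    X.tho' d (k - 2 * i) (l - 2 * j) (d.comp φ i j) x
      + (k - i) * X.tau d x * d.comp φ (i + 1) j x
      + i * X.kappa' d x * d.comp φ (i - 1) j x
      + (l - j) * conj (X.tau d x) * d.comp φ i (j + 1) x
      + j * conj (X.kappa' d x) * d.comp φ i (j - 1) x := by
  simp [nablaComp, tho', tau, kappa', Dyad.upperConj, Dyad.upper]
  ring

end SpinSpacetime

end

theorem numOnes_comp_perm_castSucc {n : ℕ} (a : Fin (n + 1) → Fin 2)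
    (s : Equiv.Perm (Fin (n + 1))) :
    numOnes (fun r : Fin n => a (s r.castSucc)) = numOnes a - ((a (s (Fin.last n)) : ℕ) : ℤ) := by
  rw [← numOnes_comp_perm s a]
  exact numOnes_castSucc (a ∘ s)

section

variable {M : Type*} [TopologicalSpace M] [ChartedSpace E4 M] [IsManifold 𝓘(ℝ, E4) ∞ M]

namespace SpinSpacetime

variable (X : SpinSpacetime M) (d : Dyad M) {k l : ℕ} {i j : ℤ} (x : M)

/-- Both indices of `∇` are contracted, so every permutation contributes the same value. A
derivative slot along `ι` pairs with an added index `o` of `φ`, and one along `o` with an added `ι`,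
which raises `i` or `j` by one. -/
theorem comp_fundD {φ : SpinorField M (k + 1) (l + 1)} (hφ : φ ∈ symSpinors M (k + 1) (l + 1))
    (hi : 0 ≤ i) (hi' : i ≤ k) (hj : 0 ≤ j) (hj' : j ≤ l) :
    d.comp (k := k) (l := l) (X.fundD φ) i j x =
      X.nablaComp d φ 1 1 i j x - X.nablaComp d φ 1 0 i (j + 1) x
        - X.nablaComp d φ 0 1 (i + 1) j x + X.nablaComp d φ 0 0 (i + 1) (j + 1) x := by
  have h := d.comp_symmetrize (fun A A' x => ∑ B, ∑ C, eps B C * ∑ B', ∑ C', eps B' C' *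
      X.nabla φ C C' (Fin.snoc A B) (Fin.snoc A' B') x)
    (stdIndex ((k : ℤ) - i).toNat k) (stdIndex ((l : ℤ) - j).toNat l) x
  rw [← fundD_eq] at h
  simp only [d.dyadComp_contract_contract x (X.nabla φ), X.blockComp_nabla d hφ, numOnes_snoc,
    numOnes_comp_perm, numOnes_stdIndex hi hi', numOnes_stdIndex hj hj', average_const] at h
  simpa using h

/-- The summand depends on the unprimed permutation only through the label `c` in the derivative
slot, which leaves `i - c` ones for `φ`; `average_perm_left` supplies the weights. -/
theorem comp_fundC {φ : SpinorField M k (l + 1)} (hφ : φ ∈ symSpinors M k (l + 1))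
    (hi : 0 ≤ i) (hi' : i ≤ k + 1) (hj : 0 ≤ j) (hj' : j ≤ l) :
    d.comp (k := k + 1) (l := l) (X.fundC φ) i j x =
      ((k + 1 - i) * (X.nablaComp d φ 0 1 i j x - X.nablaComp d φ 0 0 i (j + 1) x)
        + i * (X.nablaComp d φ 1 1 (i - 1) j x - X.nablaComp d φ 1 0 (i - 1) (j + 1) x)) /
        (k + 1) := by
  have h := d.comp_symmetrize (fun A A' x => ∑ B', ∑ C', eps B' C' *
      X.nabla φ (A (Fin.last k)) C' (fun r => A r.castSucc) (Fin.snoc A' B') x)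
    (stdIndex (((k + 1 : ℕ) : ℤ) - i).toNat (k + 1)) (stdIndex ((l : ℤ) - j).toNat l) x
  have hi'' : i ≤ ((k + 1 : ℕ) : ℤ) := by exact_mod_cast hi'
  have e := numOnes_stdIndex hi hi''
  rw [← fundC_eq] at h
  simp only [d.dyadComp_prepend_contract x (X.nabla φ), X.blockComp_nabla d hφ, numOnes_snoc,
    numOnes_comp_perm_castSucc, numOnes_comp_perm, e, numOnes_stdIndex hj hj', Function.comp_apply] at h
  rw [average_perm_left (Fin.last k) _ fun c => X.nablaComp d φ c 1 (i - ((c : ℕ) : ℤ))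
    (j + (((0 : Fin 2) : ℕ) : ℤ)) x - X.nablaComp d φ c 0 (i - ((c : ℕ) : ℤ))
    (j + (((1 : Fin 2) : ℕ) : ℤ)) x, e] at h
  simpa using h

theorem comp_fundCdag {φ : SpinorField M (k + 1) l} (hφ : φ ∈ symSpinors M (k + 1) l)
    (hi : 0 ≤ i) (hi' : i ≤ k) (hj : 0 ≤ j) (hj' : j ≤ l + 1) :
    d.comp (k := k) (l := l + 1) (X.fundCdag φ) i j x =
      ((l + 1 - j) * (X.nablaComp d φ 1 0 i j x - X.nablaComp d φ 0 0 (i + 1) j x)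
        + j * (X.nablaComp d φ 1 1 i (j - 1) x - X.nablaComp d φ 0 1 (i + 1) (j - 1) x)) /
        (l + 1) := by
  have h := d.comp_symmetrize (fun A A' x => ∑ B, ∑ C, eps B C *
      X.nabla φ C (A' (Fin.last l)) (Fin.snoc A B) (fun r => A' r.castSucc) x)
    (stdIndex ((k : ℤ) - i).toNat k) (stdIndex (((l + 1 : ℕ) : ℤ) - j).toNat (l + 1)) x
  have hj'' : j ≤ ((l + 1 : ℕ) : ℤ) := by exact_mod_cast hj'
  have e := numOnes_stdIndex hj hj''
  rw [← fundCdag_eq] at h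
  simp only [d.dyadComp_contract_prepend x (X.nabla φ), X.blockComp_nabla d hφ, numOnes_snoc,
    numOnes_comp_perm_castSucc, numOnes_comp_perm, e, numOnes_stdIndex hi hi', Function.comp_apply] at h
  rw [average_perm_right (Fin.last l) _ fun c => X.nablaComp d φ 1 c
    (i + (((0 : Fin 2) : ℕ) : ℤ)) (j - ((c : ℕ) : ℤ)) x - X.nablaComp d φ 0 c
    (i + (((1 : Fin 2) : ℕ) : ℤ)) (j - ((c : ℕ) : ℤ)) x, e] at h
  simpa using h

/-- Neither index of `∇` is contracted, so both slots are averaged and the two weights multiply. -/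
theorem comp_fundT {φ : SpinorField M k l} (hφ : φ ∈ symSpinors M k l)
    (hi : 0 ≤ i) (hi' : i ≤ k + 1) (hj : 0 ≤ j) (hj' : j ≤ l + 1) :
    d.comp (X.fundT φ) i j x =
      ((k + 1 - i) * ((l + 1 - j) * X.nablaComp d φ 0 0 i j x
          + j * X.nablaComp d φ 0 1 i (j - 1) x)
        + i * ((l + 1 - j) * X.nablaComp d φ 1 0 (i - 1) j x
          + j * X.nablaComp d φ 1 1 (i - 1) (j - 1) x)) / ((k + 1) * (l + 1)) := by
  have h := d.comp_symmetrize (fun A A' x => X.nabla φ (A (Fin.last k)) (A' (Fin.last l))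
      (fun r => A r.castSucc) (fun r => A' r.castSucc) x)
    (stdIndex (((k + 1 : ℕ) : ℤ) - i).toNat (k + 1))
    (stdIndex (((l + 1 : ℕ) : ℤ) - j).toNat (l + 1)) x
  have hi'' : i ≤ ((k + 1 : ℕ) : ℤ) := by exact_mod_cast hi'
  have hj'' : j ≤ ((l + 1 : ℕ) : ℤ) := by exact_mod_cast hj'
  have e := numOnes_stdIndex hi hi''
  have e' := numOnes_stdIndex hj hj''
  rw [← fundT_eq] at h
  simp only [d.dyadComp_prepend_prepend x (X.nabla φ), X.blockComp_nabla d hφ,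
    numOnes_comp_perm_castSucc, e, e', Function.comp_apply] at h
  rw [average_perm_both (Fin.last k) (Fin.last l) _ _ fun c c' => X.nablaComp d φ c c'
    (i - ((c : ℕ) : ℤ)) (j - ((c' : ℕ) : ℤ)) x, e, e'] at h
  simpa using h

end SpinSpacetime

end

end GHP

end

theorem mainTheorem6 {M : Type*} [TopologicalSpace M] [ChartedSpace GHP.E4 M]
    [IsManifold 𝓘(ℝ, GHP.E4) ∞ M] (X : GHP.SpinSpacetime M) (d : GHP.Dyad M) {k l : ℕ}
    (φ : GHP.SpinorField M k l) (hφ : φ ∈ GHP.symSpinors M k l) (x : M) :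
    -- the components of `φ` and the GHP operators acting on them (with weight `{k-2i, l-2j}`)
    let f : ℤ → ℤ → ℂ := fun i j => d.comp φ i j x
    let tho : ℤ → ℤ → ℂ := fun i j => X.tho d (k - 2 * i) (l - 2 * j) (d.comp φ i j) x
    let tho' : ℤ → ℤ → ℂ := fun i j => X.tho' d (k - 2 * i) (l - 2 * j) (d.comp φ i j) x
    let edt : ℤ → ℤ → ℂ := fun i j => X.edt d (k - 2 * i) (l - 2 * j) (d.comp φ i j) x
    let edt' : ℤ → ℤ → ℂ := fun i j => X.edt' d (k - 2 * i) (l - 2 * j) (d.comp φ i j) x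
    let κ : ℂ := X.kappa d x
    let σ : ℂ := X.sigma d x
    let ρ : ℂ := X.rho d x
    let τ : ℂ := X.tau d x
    let κ' : ℂ := X.kappa' d x
    let σ' : ℂ := X.sigma' d x
    let ρ' : ℂ := X.rho' d x
    let τ' : ℂ := X.tau' d x
    (∀ i j : ℤ, 0 ≤ i → i ≤ k - 1 → 0 ≤ j → j ≤ l - 1 →
      d.comp (X.fundD φ) i j x =
        (tho (i + 1) (j + 1) - ((k - i) * ρ + (l - j) * conj ρ) * f (i + 1) (j + 1))
        + (tho' i j - ((i + 1) * ρ' + (j + 1) * conj ρ') * f i j)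
        - (edt (i + 1) j - ((k - i) * τ + (j + 1) * conj τ') * f (i + 1) j)
        - (edt' i (j + 1) - ((i + 1) * τ' + (l - j) * conj τ) * f i (j + 1))
        + (k - i - 1) * κ * f (i + 2) (j + 1)
        - (k - i - 1) * σ * f (i + 2) j
        - i * σ' * f (i - 1) (j + 1)
        + i * κ' * f (i - 1) j
        + (l - j - 1) * conj κ * f (i + 1) (j + 2)
        - (l - j - 1) * conj σ * f i (j + 2)
        - j * conj σ' * f (i + 1) (j - 1)
        + j * conj κ' * f i (j - 1)) ∧
    (∀ i j : ℤ, 0 ≤ i → i ≤ k + 1 → 0 ≤ j → j ≤ l - 1 →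
      d.comp (X.fundC φ) i j x =
        (-(k - i + 1) * (tho i (j + 1) + (i * ρ - (l - j) * conj ρ) * f i (j + 1))
        + i * (tho' (i - 1) j + ((k - i + 1) * ρ' - (j + 1) * conj ρ') * f (i - 1) j)
        + (k - i + 1) * (edt i j + (i * τ - (j + 1) * conj τ') * f i j)
        - i * (edt' (i - 1) (j + 1)
            + ((k - i + 1) * τ' - (l - j) * conj τ) * f (i - 1) (j + 1))
        - (k - i + 1) * (k - i) * κ * f (i + 1) (j + 1)
        + (k - i + 1) * (k - i) * σ * f (i + 1) j
        - i * (i - 1) * σ' * f (i - 2) (j + 1)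
        + i * (i - 1) * κ' * f (i - 2) j
        - (k - i + 1) * (l - j - 1) * conj κ * f i (j + 2)
        - i * (l - j - 1) * conj σ * f (i - 1) (j + 2)
        + (k - i + 1) * j * conj σ' * f i (j - 1)
        + i * j * conj κ' * f (i - 1) (j - 1)) / (k + 1)) ∧
    (∀ i j : ℤ, 0 ≤ i → i ≤ k - 1 → 0 ≤ j → j ≤ l + 1 →
      d.comp (X.fundCdag φ) i j x =
        (-(l - j + 1) * (tho (i + 1) j + (j * conj ρ - (k - i) * ρ) * f (i + 1) j)
        + j * (tho' i (j - 1) + ((l - j + 1) * conj ρ' - (i + 1) * ρ') * f i (j - 1))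
        + (l - j + 1) * (edt' i j + (j * conj τ - (i + 1) * τ') * f i j)
        - j * (edt (i + 1) (j - 1)
            + ((l - j + 1) * conj τ' - (k - i) * τ) * f (i + 1) (j - 1))
        - (l - j + 1) * (l - j) * conj κ * f (i + 1) (j + 1)
        + (l - j + 1) * (l - j) * conj σ * f i (j + 1)
        - j * (j - 1) * conj σ' * f (i + 1) (j - 2)
        + j * (j - 1) * conj κ' * f i (j - 2)
        - (l - j + 1) * (k - i - 1) * κ * f (i + 2) j
        - j * (k - i - 1) * σ * f (i + 2) (j - 1)
        + (l - j + 1) * i * σ' * f (i - 1) j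
        + i * j * κ' * f (i - 1) (j - 1)) / (l + 1)) ∧
    (∀ i j : ℤ, 0 ≤ i → i ≤ k + 1 → 0 ≤ j → j ≤ l + 1 →
      d.comp (X.fundT φ) i j x =
        ((k + 1 - i) * (l + 1 - j) * (tho i j + (i * ρ + j * conj ρ) * f i j)
        + (k + 1 - i) * j
            * (edt i (j - 1) + (i * τ + (l - j + 1) * conj τ') * f i (j - 1))
        + i * (l + 1 - j)
            * (edt' (i - 1) j + ((k - i + 1) * τ' + j * conj τ) * f (i - 1) j)
        + i * j * (tho' (i - 1) (j - 1)
            + ((k - i + 1) * ρ' + (l - j + 1) * conj ρ') * f (i - 1) (j - 1))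
        + (k - i + 1) * (k - i) * (l + 1 - j) * κ * f (i + 1) j
        + (k - i + 1) * (k - i) * j * σ * f (i + 1) (j - 1)
        + i * (i - 1) * (l + 1 - j) * σ' * f (i - 2) j
        + i * (i - 1) * j * κ' * f (i - 2) (j - 1)
        + (k + 1 - i) * (l + 1 - j) * (l - j) * conj κ * f i (j + 1)
        + i * (l + 1 - j) * (l - j) * conj σ * f (i - 1) (j + 1)
        + (k + 1 - i) * j * (j - 1) * conj σ' * f i (j - 2)
        + i * j * (j - 1) * conj κ' * f (i - 1) (j - 2)) / ((k + 1) * (l + 1))) := by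
  intro f tho tho' edt edt' κ σ ρ τ κ' σ' ρ' τ'
  refine ⟨fun i j hi hi' hj hj' => ?_, fun i j hi hi' hj hj' => ?_, fun i j hi hi' hj hj' => ?_,
    fun i j hi hi' hj hj' => ?_⟩
  -- A nonempty index range forces `k ≥ 1` and `l ≥ 1`, so the zero branches of `fundD` do not
  -- occur.
  · obtain ⟨n, rfl⟩ : ∃ n, k = n + 1 := ⟨k - 1, by omega⟩
    obtain ⟨m, rfl⟩ : ∃ m, l = m + 1 := ⟨l - 1, by omega⟩
    refine (X.comp_fundD d x hφ hi (by omega) hj (by omega)).trans ?_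
    -- The integer indices are brought to a common form so that `ring` identifies equal components.
    -- The shifts cancel in part: for example the `ρ` term of the `ð'` component at `(i, j+1)` lands
    -- on `φ_{(i+1)(j+1)'}` and joins the `þ` term.
    simp only [GHP.SpinSpacetime.nablaComp_zero_zero, GHP.SpinSpacetime.nablaComp_zero_one,
      GHP.SpinSpacetime.nablaComp_one_zero, GHP.SpinSpacetime.nablaComp_one_one,
      f, tho, tho', edt, edt', κ, σ, ρ, τ, κ', σ', ρ', τ', add_sub_cancel_right,
      show i + 2 = i + 1 + 1 by ring, show j + 2 = j + 1 + 1 by ring]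
    push_cast
    ring
  · obtain ⟨m, rfl⟩ : ∃ m, l = m + 1 := ⟨l - 1, by omega⟩
    -- Both sides carry the denominator `k + 1` from the average, so only the numerators are
    -- compared.
    refine (X.comp_fundC d x hφ hi hi' hj (by omega)).trans (congrArg (· / ((k : ℂ) + 1)) ?_)
    simp only [GHP.SpinSpacetime.nablaComp_zero_zero, GHP.SpinSpacetime.nablaComp_zero_one,
      GHP.SpinSpacetime.nablaComp_one_zero, GHP.SpinSpacetime.nablaComp_one_one,
      f, tho, tho', edt, edt', κ, σ, ρ, τ, κ', σ', ρ', τ', add_sub_cancel_right, sub_add_cancel,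
      show i - 2 = i - 1 - 1 by ring, show j + 2 = j + 1 + 1 by ring]
    push_cast
    ring
  · obtain ⟨n, rfl⟩ : ∃ n, k = n + 1 := ⟨k - 1, by omega⟩
    refine (X.comp_fundCdag d x hφ hi (by omega) hj hj').trans (congrArg (· / ((l : ℂ) + 1)) ?_)
    simp only [GHP.SpinSpacetime.nablaComp_zero_zero, GHP.SpinSpacetime.nablaComp_zero_one,
      GHP.SpinSpacetime.nablaComp_one_zero, GHP.SpinSpacetime.nablaComp_one_one,
      f, tho, tho', edt, edt', κ, σ, ρ, τ, κ', σ', ρ', τ', add_sub_cancel_right, sub_add_cancel,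
      show i + 2 = i + 1 + 1 by ring, show j - 2 = j - 1 - 1 by ring]
    push_cast
    ring
  · refine (X.comp_fundT d x hφ hi hi' hj hj').trans
      (congrArg (· / (((k : ℂ) + 1) * ((l : ℂ) + 1))) ?_)
    simp only [GHP.SpinSpacetime.nablaComp_zero_zero, GHP.SpinSpacetime.nablaComp_zero_one,
      GHP.SpinSpacetime.nablaComp_one_zero, GHP.SpinSpacetime.nablaComp_one_one,
      f, tho, tho', edt, edt', κ, σ, ρ, τ, κ', σ', ρ', τ', sub_add_cancel,
      show i - 2 = i - 1 - 1 by ring, show j - 2 = j - 1 - 1 by ring]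
    push_cast
    ring
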